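/- **Setting.** Let $\mathcal G$ be a connected undirected simple graph with $n\ge 2$ nodes (agents), node set $\mathcal V$, edge set $\mathcal E$, neighbour sets $N_i$ and Laplacian $L=DD^\top$ ($D$ an oriented incidence matrix). Let $\Delta>0$ be the communication radius and let $d_{ij}\in\mathbb R^p$, $(i,j)\in\mathcal E$, be desired displacements which are feasible (there are $\tau_1,\dots,\tau_n\in\mathbb R^p$ with $\tau_i-\tau_j=d_{ij}$ for all $(i,j)\in\mathcal E$) and satisfy $\|d_{ij}\|<\Delta$. For a matrix $M$ let $\rho(M)$ be its spectral radius and $\rho_2(M)$ its minimum positive eigenvalue. Put $\Delta_0=\max_{(i,j)\in\mathcal E}(\Delta-\|d_{ij}\|)$ and $\beta_0=\rho_2(L)/\Delta_0$. Consider the double integrators $\dot x_i=q_i$, $\dot q_i=u_i$, $i\in\mathcal V$, with states in $\mathbb R^p$, and for $(i,j)\in\mathcal E$ put $$\omega_{ij}(t)=\frac{2\Delta-2\|d_{ij}\|-\|x_i(t)-x_j(t)-d_{ij}\|}{(\Delta-\|d_{ij}\|-\|x_i(t)-x_j(t)-d_{ij}\|)^2}.$$ **Parameters.** Let $0<\beta_1\le\beta_0$,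 let $C=\begin{pmatrix}0&1\\0&0\end{pmatrix}$, $B=\begin{pmatrix}0\\1\end{pmatrix}$, and let $k_0,k_1,k_2>0$ be such that $P=\begin{pmatrix}k_0&k_1\\k_1&k_2\end{pmatrix}$ satisfies $$P>0,\qquad \tfrac12(PC+C^\top P)-\beta_1PBB^\top P+2I_2\le0 .$$ Let $0<k_3<\frac{4}{k_2+\sqrt{k_1^2+k_2^2}}$, $k_4=k_3\frac{k_2+\sqrt{k_1^2+k_2^2}}2$ (so $k_4<2$), $\alpha_d>0$ and $0<\beta_d<(2-k_4)\rho_2(P)$. **Event-triggered controller.** Agent $i$ has triggering times $0=t^i_1<t^i_2<\cdots$ (finitely or infinitely many). If $s=s_i(t)$ is its last triggering time not later than $t$, then $$u_i(t)=-k_1\sum_{j\in N_i}\omega_{ij}(s)(x_i(s)-x_j(s)-d_{ij})-k_2\sum_{j\in N_i}\omega_{ij}(s)(q_i(s)-q_j(s))-k_3q_i(t).$$ For a triggering time $s$ and $t\ge s$ let $E_i(s,t)=k_1\big[\sum_{j\in N_i}\omega_{ij}(r)(x_i(r)-x_j(r)-d_{ij})\big]_{r=s}^{r=t}+k_2\big[\sum_{j\in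 N_i}\omega_{ij}(r)(q_i(r)-q_j(r))\big]_{r=s}^{r=t}$. The data of $t^i_k$ are held as long as $\|E_i(t^i_k,t)\|\le\alpha_de^{-\beta_dt}$: the next triggering time $t^i_{k+1}$ is a time at which equality holds and up to which, from $t^i_k$ on, the inequality has held; if there is no further triggering time, the inequality holds at all later times. (This covers both the largest time up to which the inequality can be kept by holding the data and the first time of equality.) An *execution* on $[0,T)$, $0<T\le\infty$, consists of functions $x_i,q_i$ and triggering times in $[0,T)$ obeying these rules, where the triggering times of an agent may accumulate at $T$ but nowhere before $T$; here $q_i$ is continuous, $\dot x_i=q_i$, and $\dot q_i=u_i$ holds for the right derivative, since $u_i$ jumps at triggering times. An execution is *maximal* if it cannot be continued to a larger interval. **Theorem.** (a) There is $\gamma>0$, depending only on the network and the parameters, such that for all initial states with $\|x_i(0)-x_j(0)-d_{ij}\|<\Delta-\|d_{ij}\|$ for all $(i,j)\in\mathcal E$ there is a constant $c$ such that every execution on $[0,T)$ with this initial state satisfies: 1. (no Zeno behavior) every agent has only finitely many triggering times in every bounded time interval; and if the execution is maximal, then $T=\infty$; 2. (connectivity preservation) $\|x_i(t)-x_j(t)\|\le\Delta$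 for all $(i,j)\in\mathcal E$ and all $t\in[0,T)$; 3. (exponential convergence to the formation) $\|x_i(t)-x_j(t)-d_{ij}\|\le ce^{-\gamma t}$ for all $(i,j)\in\mathcal E$, and $\|q_i(t)-q_j(t)\|\le ce^{-\gamma t}$ for all $i,j\in\mathcal V$, for all $t\in[0,T)$; 4. if $T=\infty$, then $\lim_{t\to\infty}q_i(t)=0$ for all $i\in\mathcal V$. (b) If moreover $\beta_d<(2-k_4)/\rho(P)$, then for every initial state as in (a) there are constants $c$ and $\xi_i>0$, $i\in\mathcal V$, such that for every execution with this initial state the estimates in 3. hold with $\gamma=\beta_d$, and $t^i_{k+1}-t^i_k\ge\xi_i$ for any two successive triggering times of agent $i$, for every $i\in\mathcal V$. -/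

import Mathlib

open scoped Matrix
open Filter Topology

noncomputable section

namespace FormationControl

/-- A communication graph, a communication radius `Δ`, and desired internode displacements
`d i j ∈ ℝᵖ` (only their values on edges are used). -/
structure Network (V : Type*) (p : ℕ) where
  graph : SimpleGraph V
  Δ : ℝ
  d : V → V → EuclideanSpace ℝ (Fin p)

/-- The real parameters of the event-triggered controller: the gains `k₁, k₂, k₃` and the
parameters `α, β` of the threshold `α e^{-β t}`. -/
structure Gains where
  k₁ : ℝ
  k₂ : ℝ
  k₃ : ℝ
  α : ℝ
  β : ℝ

/-- The minimum positive (real) eigenvalue `ρ₂(M)` of a square matrix having one. -/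
def minPosEigenvalue {m : Type*} [Fintype m] (M : Matrix m m ℝ) : ℝ :=
  open Classical in sInf {μ : ℝ | 0 < μ ∧ Module.End.HasEigenvalue (Matrix.toLin' M) μ}

section Network

variable {V : Type*} {p : ℕ} (N : Network V p)

/-- The formation is feasible: the displacements on the edges come from some configuration. -/
def Network.Feasible : Prop :=
  ∃ τ : V → EuclideanSpace ℝ (Fin p), ∀ i j, N.graph.Adj i j → τ i - τ j = N.d i j

/-- `Δ₀ = max_{(i,j) ∈ E} (Δ - ‖d_ij‖)`. -/
def Network.Δ₀ : ℝ :=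
  sSup {r : ℝ | ∃ i j, N.graph.Adj i j ∧ r = N.Δ - ‖N.d i j‖}

/-- `β₀ = ρ₂(L) / Δ₀`, where `L` is the Laplacian of the graph, that is `D Dᵀ` for
any oriented incidence matrix `D`. -/
def Network.β₀ [Fintype V] : ℝ :=
  open Classical in minPosEigenvalue (N.graph.lapMatrix ℝ) / N.Δ₀

/-- The weight `ω_ij` at the configuration `x`; it vanishes when `(i,j)` is not an edge. -/
def Network.weight (x : V → EuclideanSpace ℝ (Fin p)) (i j : V) : ℝ :=
  open Classical in
  if N.graph.Adj i j then
    (2 * N.Δ - 2 * ‖N.d i j‖ - ‖x i - x j - N.d i j‖) /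
      (N.Δ - ‖N.d i j‖ - ‖x i - x j - N.d i j‖) ^ 2
  else 0

/-- `∑_{j ∈ N_i} ω_ij (x_i - x_j - d_ij)` (the summands of non-neighbours are zero). -/
def Network.posFeedback [Fintype V] (x : V → EuclideanSpace ℝ (Fin p)) (i : V) :
    EuclideanSpace ℝ (Fin p) :=
  ∑ j, N.weight x i j • (x i - x j - N.d i j)

/-- `∑_{j ∈ N_i} ω_ij (q_i - q_j)` (the summands of non-neighbours are zero). -/
def Network.velFeedback [Fintype V] (x q : V → EuclideanSpace ℝ (Fin p)) (i : V) :
    EuclideanSpace ℝ (Fin p) :=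
  ∑ j, N.weight x i j • (q i - q j)

/-- The initial position condition `‖x_i - x_j - d_ij‖ < Δ - ‖d_ij‖` on all edges. -/
def Network.InitialOK (x : V → EuclideanSpace ℝ (Fin p)) : Prop :=
  ∀ i j, N.graph.Adj i j → ‖x i - x j - N.d i j‖ < N.Δ - ‖N.d i j‖

end Network

/-- `s'` is the triggering time that directly follows `s` in the set `S` of triggering times. -/
def IsNextTrigger (S : Set ℝ) (s s' : ℝ) : Prop :=
  s ∈ S ∧ s' ∈ S ∧ s < s' ∧ ∀ r ∈ S, s < r → s' ≤ r

/-- The last triggering time that is at most `t`. -/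
def lastTrigger (S : Set ℝ) (t : ℝ) : ℝ := sSup (S ∩ Set.Iic t)

section Execution

variable {V : Type*} [Fintype V] {p : ℕ} (N : Network V p) (g : Gains)

/-- The measurement error `E_i(t) = k₁ e_i(t) + k₂ e_{qi}(t)` of agent `i` at time `t`, when its
last update took place at time `s`. -/
def triggerError (x q : ℝ → V → EuclideanSpace ℝ (Fin p)) (i : V) (s t : ℝ) :
    EuclideanSpace ℝ (Fin p) :=
  g.k₁ • (N.posFeedback (x t) i - N.posFeedback (x s) i) +
    g.k₂ • (N.velFeedback (x t) (q t) i - N.velFeedback (x s) (q s) i)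

/-- The control input `u_i(t)`, when the triggering times of agent `i` form the set `S`. -/
def controlInput (x q : ℝ → V → EuclideanSpace ℝ (Fin p)) (S : Set ℝ) (i : V) (t : ℝ) :
    EuclideanSpace ℝ (Fin p) :=
  -(g.k₁ • N.posFeedback (x (lastTrigger S t)) i)
    - g.k₂ • N.velFeedback (x (lastTrigger S t)) (q (lastTrigger S t)) i
    - g.k₃ • q t i

/-- `(x, q)`, with the sets `S i` of triggering times of the agents, is an execution on `[0, T)`,
`0 < T ≤ ∞`, of the double integrators under the event-triggered controller.

Triggering times may be finite or infinite in number, and they may accumulate at `T` (nowhere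
earlier, so that each `t < T` has a last triggering time).

`fire` and `bound` are the triggering rule: after an update at `s`, the agent keeps its data as long
as `‖E_i‖ ≤ α e^{-β t}`. The next update takes place at a time when the threshold is
reached, before it has ever been exceeded; if that never happens there is no further update.
(Both the largest time up to which the inequality can be kept by holding the data, and the first time
of equality, are of this kind.) -/
structure IsExecution (T : EReal) (x q : ℝ → V → EuclideanSpace ℝ (Fin p)) (S : V → Set ℝ) :
    Prop where
  pos : 0 < T
  zero_mem : ∀ i, (0 : ℝ) ∈ S i
  mem_range : ∀ i, ∀ s ∈ S i, 0 ≤ s ∧ (s : EReal) < T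
  finite : ∀ i, ∀ t : ℝ, (t : EReal) < T → (S i ∩ Set.Iic t).Finite
  deriv_x : ∀ i, ∀ t : ℝ, 0 ≤ t → (t : EReal) < T →
    HasDerivWithinAt (fun r => x r i) (q t i) (Set.Ici 0) t
  cont_q : ∀ i, ContinuousOn (fun r => q r i) {t : ℝ | 0 ≤ t ∧ (t : EReal) < T}
  /- the input jumps at triggering times and is right-continuous: hence the right derivative -/
  deriv_q : ∀ i, ∀ t : ℝ, 0 ≤ t → (t : EReal) < T →
    HasDerivWithinAt (fun r => q r i) (controlInput N g x q (S i) i t) (Set.Ici t) t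
  bound : ∀ i, ∀ s ∈ S i, ∀ t : ℝ, s ≤ t → (t : EReal) < T → (∀ r ∈ S i, s < r → t ≤ r) →
    ‖triggerError N g x q i s t‖ ≤ g.α * Real.exp (-g.β * t)
  fire : ∀ i s s', IsNextTrigger (S i) s s' →
    ‖triggerError N g x q i s s'‖ = g.α * Real.exp (-g.β * s')

/-- An execution that cannot be continued to a larger time interval. In particular an execution
whose triggering times accumulate at a finite `T` (Zeno behaviour) is maximal. -/
def IsMaximalExecution (T : EReal) (x q : ℝ → V → EuclideanSpace ℝ (Fin p)) (S : V → Set ℝ) :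
    Prop :=
  IsExecution N g T x q S ∧
    ¬ ∃ (T' : EReal) (x' q' : ℝ → V → EuclideanSpace ℝ (Fin p)) (S' : V → Set ℝ),
      T < T' ∧ IsExecution N g T' x' q' S' ∧
      (∀ t : ℝ, 0 ≤ t → (t : EReal) < T → x' t = x t ∧ q' t = q t) ∧
      (∀ i, ∀ t : ℝ, (t : EReal) < T → (t ∈ S' i ↔ t ∈ S i))

end Execution

end FormationControl

end

/-! Holding data only perturbs the continuous feedback: agent `i` obeys the unsampled law plus an
error `e_i`, and the triggering rule gives `‖e_i‖ ≤ α e^{-βt}`. This closed loop is studied through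
two Lyapunov functions.

The energy is the sum of the edge potentials `r²/(a - r)`, `a = Δ - ‖d_ij‖`, and the kinetic energy.
The weights make the position feedback the gradient of the potentials, so its work cancels; the
weighted velocity feedback dissipates, and the damping `k₃` absorbs `e` up to an integrable term.
Hence the energy stays bounded, and since the potential blows up at `r = a`, every edge keeps `r ≤
R_ij < a` (`exists_radius`).

The disagreement is the quadratic form of `P` summed over all pairs of agents. On admissible
configurations the weights are at least `1/Δ₀`, so by the Poincaré inequality of the graph the
weighted Laplacian dominates `β₁` (`weighted_poincare`). The Riccati inequality then yields a decay
term with coefficient `2`, of which the velocity damping costs at most `k₄`. With `l` the largest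
eigenvalue of `P`, this gives `D' ≤ -2((2 - k₄)/l) D + K √D e^{-βt}`, hence decay of the differences
at every rate `γ ≤ β` with `γ < (2 - k₄)/l` (`exists_disagreement_decay`). The symmetric feedbacks
cancel in the total momentum, which decays by damping; so each velocity tends to `0`.

On the region `r ≤ R_ij` the weights are bounded and Lipschitz, so the measurement error grows after
an update at `s` at most like `K e^{-γs}(t - s)`. At the next update `s'` it equals the threshold,
whence `α e^{-βs'} ≤ K e^{-γs}(s' - s)` (`hasDecayRate`). This bounds the gaps below on bounded
intervals, and uniformly when `γ = β`.

Finally, with finitely many updates before a finite `T`, the motion is eventually that of a linear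
system with constant input; it passes smoothly through `T` and can be restarted there
(`IsExecution.exists_continuation`), so a maximal execution has `T = ∞`. -/

noncomputable section

namespace FormationControl

/-! ### Summation by parts for symmetric weights -/

section PairSums

variable {V : Type*} [Fintype V] {F : Type*} [NormedAddCommGroup F] [InnerProductSpace ℝ F]

lemma sum_sum_smul_sub_eq_zero (w : V → V → ℝ) (hw : ∀ i j, w i j = w j i) (v : V → F) :
    ∑ i, ∑ j, w i j • (v i - v j) = 0 := by
  simp only [smul_sub, Finset.sum_sub_distrib]
  rw [sub_eq_zero]
  conv_rhs => rw [Finset.sum_comm]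
  simp only [hw]

/-- Average the sum with its copy in which `i` and `j` are exchanged: this is the Dirichlet form of
the weighted Laplacian. -/
lemma two_mul_sum_inner_sum_smul_sub (w : V → V → ℝ) (hw : ∀ i j, w i j = w j i) (u v : V → F) :
    2 * ∑ i, inner ℝ (u i) (∑ j, w i j • (v i - v j)) =
      ∑ i, ∑ j, w i j * inner ℝ (u i - u j) (v i - v j) := by
  have h1 : ∑ i, inner ℝ (u i) (∑ j, w i j • (v i - v j)) =
      ∑ i, ∑ j, w i j * inner ℝ (u i) (v i - v j) := by
    simp only [inner_sum, real_inner_smul_right]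
  have h2 : ∑ i, inner ℝ (u i) (∑ j, w i j • (v i - v j)) =
      ∑ i, ∑ j, w i j * inner ℝ (-u j) (v i - v j) := by
    rw [h1, Finset.sum_comm]
    refine Finset.sum_congr rfl fun i _ => Finset.sum_congr rfl fun j _ => ?_
    rw [hw j i, ← neg_sub (v i) (v j), inner_neg_right, inner_neg_left]
  rw [two_mul]
  nth_rewrite 1 [h1]
  rw [h2]
  simp only [← Finset.sum_add_distrib]
  refine Finset.sum_congr rfl fun i _ => Finset.sum_congr rfl fun j _ => ?_
  rw [← mul_add, ← inner_add_left, sub_eq_add_neg (u i)]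

lemma sum_sum_inner_sub_sub (u v : V → F) :
    ∑ i, ∑ j, inner ℝ (u i - u j) (v i - v j) =
      2 * (Fintype.card V : ℝ) * ∑ i, inner ℝ (u i) (v i) - 2 * inner ℝ (∑ i, u i) (∑ i, v i) := by
  simp only [inner_sub_left, inner_sub_right, Finset.sum_sub_distrib, Finset.sum_const,
    Finset.card_univ, nsmul_eq_mul, ← inner_sum, ← sum_inner, ← Finset.mul_sum]
  ring

/-- The image of the Laplacian has sum zero, so the mean term of `sum_sum_inner_sub_sub` drops out
and only the factor `n` is left. -/
lemma sum_sum_inner_sub_weighted (w : V → V → ℝ) (hw : ∀ i j, w i j = w j i) (u v : V → F) :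
    ∑ i, ∑ j, inner ℝ (u i - u j)
        ((∑ k, w i k • (v i - v k)) - ∑ k, w j k • (v j - v k)) =
      Fintype.card V * ∑ i, ∑ j, w i j * inner ℝ (u i - u j) (v i - v j) := by
  rw [sum_sum_inner_sub_sub u (fun i => ∑ k, w i k • (v i - v k)),
    sum_sum_smul_sub_eq_zero w hw, inner_zero_right, ← two_mul_sum_inner_sum_smul_sub w hw u v]
  ring

/-- A binary quadratic form with nonnegative coefficients and discriminant is nonnegative on
vectors. -/
lemma quadratic_inner_nonneg {a b c : ℝ} (ha : 0 ≤ a) (hc : 0 ≤ c) (h : b ^ 2 ≤ a * c) (u v : F) :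
    0 ≤ a * ‖u‖ ^ 2 + 2 * b * inner ℝ u v + c * ‖v‖ ^ 2 := by
  have h1 : |b| ≤ √a * √c := by
    rw [← Real.sqrt_mul ha]
    exact Real.abs_le_sqrt h
  have h2 : |b * inner ℝ u v| ≤ (√a * √c) * (‖u‖ * ‖v‖) := by
    rw [abs_mul]
    exact mul_le_mul h1 (abs_real_inner_le_norm u v) (abs_nonneg _) (by positivity)
  have h3 := (abs_le.1 h2).1
  have h4 := sq_nonneg (√a * ‖u‖ - √c * ‖v‖)
  nlinarith [Real.sq_sqrt ha, Real.sq_sqrt hc]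

end PairSums

/-! ### A scalar differential inequality -/

section Comparison

/-- Exponential decay of the solutions of `f' ≤ -2μ f + K √f e^{-βt}`. -/
lemma exists_decay_bound {μ γ : ℝ} (K v : ℝ) (hK : 0 ≤ K) (hγ : γ < μ) :
    ∃ A : ℝ, 0 < A ∧ ∀ (β b : ℝ) (f f' : ℝ → ℝ), γ ≤ β → ContinuousOn f (Set.Icc 0 b) →
      (∀ t ∈ Set.Ico 0 b, HasDerivWithinAt f (f' t) (Set.Ici t) t) → f 0 ≤ v →
      (∀ t ∈ Set.Ico 0 b, f' t ≤ -(2 * μ) * f t + K * √(f t) * Real.exp (-β * t)) →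
      ∀ t ∈ Set.Icc 0 b, f t ≤ A * Real.exp (-(2 * γ) * t) := by
  -- The barrier `A e^{-2γt}` works once `K √A < 2(μ - γ) A`, that is `√A > K / (2(μ - γ))`; the `+
  -- 1` makes this strict. The summand `|v|` in `A` covers the initial value.
  set r := K / (2 * (μ - γ)) + 1 with hr
  have hμγ : 0 < μ - γ := sub_pos.2 hγ
  have hr0 : 0 < r := by positivity
  have hrK : K < 2 * (μ - γ) * r := by
    rw [hr, mul_add, mul_div_cancel₀ _ (by positivity)]
    linarith
  refine ⟨r ^ 2 + |v|, by positivity, fun β b f f' hβ hf hf' h0 hb t ht => ?_⟩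
  set A := r ^ 2 + |v| with hA
  have hA0 : 0 < A := by positivity
  have hrA : r ≤ √A := Real.le_sqrt_of_sq_le (by rw [hA]; linarith [abs_nonneg v])
  have hB : ∀ t, HasDerivAt (fun t => A * Real.exp (-(2 * γ) * t))
      (A * (Real.exp (-(2 * γ) * t) * -(2 * γ))) t := fun t => by
    have := ((hasDerivAt_id t).const_mul (-(2 * γ))).exp.const_mul A
    simpa using this
  refine image_le_of_deriv_right_lt_deriv_boundary hf hf' ?_ hB ?_ ht
  · simp only [mul_zero, Real.exp_zero, mul_one]
    have := le_abs_self v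
    nlinarith [sq_nonneg r]
  -- The derivatives need comparing only where `f` touches the barrier, so `√f` is known there.
  · intro s hs hfs
    have h1 := hb s hs
    have h2 : √(f s) = √A * Real.exp (-γ * s) := by
      rw [hfs, Real.sqrt_mul hA0.le, ← Real.exp_half]
      congr 2
      ring
    have h3 : Real.exp (-γ * s) * Real.exp (-β * s) ≤ Real.exp (-(2 * γ) * s) := by
      rw [← Real.exp_add]
      apply Real.exp_le_exp.2
      nlinarith [hs.1]
    have he := Real.exp_pos (-(2 * γ) * s)
    have h4 : K * √(f s) * Real.exp (-β * s) ≤ K * √A * Real.exp (-(2 * γ) * s) := by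
      rw [h2]
      calc _ = K * √A * (Real.exp (-γ * s) * Real.exp (-β * s)) := by ring
        _ ≤ _ := by gcongr
    have hsA : √A * √A = A := Real.mul_self_sqrt hA0.le
    have h5 : K * √A < 2 * (μ - γ) * A := by
      have : K < 2 * (μ - γ) * √A := lt_of_lt_of_le hrK (by gcongr)
      calc K * √A < 2 * (μ - γ) * √A * √A := by
            apply mul_lt_mul_of_pos_right this (lt_of_lt_of_le hr0 hrA)
        _ = _ := by rw [mul_assoc, hsA]
    have h6 := mul_lt_mul_of_pos_right h5 he
    rw [hfs] at h1 h4
    calc f' s ≤ _ := h1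
      _ ≤ -(2 * μ) * (A * Real.exp (-(2 * γ) * s)) + K * √A * Real.exp (-(2 * γ) * s) := by
          linarith
      _ < _ := by nlinarith

end Comparison

/-! ### The edge weight and its potential -/

section Potential

/-- The weight as a function of the distance `r` and the margin `a`. -/
def weightFun (a r : ℝ) : ℝ := (2 * a - r) / (a - r) ^ 2

/-- The edge potential as a function of the squared distance. -/
def edgePotential (a w : ℝ) : ℝ := w / (a - √w)

/-- In the variable `1/(a - r)` the weight is a polynomial with nonnegative coefficients, which
gives its upper and Lipschitz bounds. -/
lemma weightFun_eq {a r : ℝ} (h : r < a) :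
    weightFun a r = 1 / (a - r) + a * (1 / (a - r)) ^ 2 := by
  have : a - r ≠ 0 := (sub_pos.2 h).ne'
  rw [weightFun]
  field_simp
  ring

lemma two_div_le_weightFun {a r : ℝ} (hr : 0 ≤ r) (h : r < a) : 2 / a ≤ weightFun a r := by
  have h1 : 0 < a - r := sub_pos.2 h
  have ha : 0 < a := by linarith
  rw [weightFun, div_le_div_iff₀ ha (by positivity)]
  nlinarith [mul_nonneg hr h1.le]

lemma weightFun_nonneg {a r : ℝ} (hr : 0 ≤ r) (h : r < a) : 0 ≤ weightFun a r :=
  le_trans (by have : 0 < a := by linarith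
               positivity) (two_div_le_weightFun hr h)

/-- This ties the weight to the potential. Using the squared distance as variable keeps the
potential differentiable where the distance is zero. -/
lemma hasDerivAt_edgePotential {a w : ℝ} (hw : 0 ≤ w) (h : √w < a) :
    HasDerivAt (edgePotential a) (weightFun a √w / 2) w := by
  have ha : 0 < a := lt_of_le_of_lt (Real.sqrt_nonneg _) h
  have h1 : a - √w ≠ 0 := (sub_pos.2 h).ne'
  rcases hw.eq_or_lt with rfl | hw
  -- At `0` the square root has no derivative, but the difference quotient is `1/(a - √y)`, which is
  -- continuous.
  · rw [hasDerivAt_iff_tendsto_slope]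
    have hc : ContinuousAt (fun w => 1 / (a - √w)) 0 := by
      refine ContinuousAt.div continuousAt_const (by fun_prop) ?_
      simpa using ha.ne'
    have hc' : Tendsto (fun w => 1 / (a - √w)) (𝓝[≠] 0) (𝓝 (weightFun a √0 / 2)) := by
      have := hc.tendsto.mono_left (nhdsWithin_le_nhds (s := {0}ᶜ))
      convert this using 2
      simp [weightFun]
      field_simp
    refine hc'.congr' ?_
    filter_upwards [self_mem_nhdsWithin] with y hy
    have hy : y ≠ 0 := hy
    simp only [slope, edgePotential, vsub_eq_sub, sub_zero, zero_div, smul_eq_mul]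
    field_simp
  · have hs : √w ≠ 0 := (Real.sqrt_pos.2 hw).ne'
    have := (hasDerivAt_id w).div ((Real.hasDerivAt_sqrt hw.ne').const_sub a) h1
    refine this.congr_deriv ?_
    simp only [id, weightFun]
    have hw' : w = √w * √w := (Real.mul_self_sqrt hw.le).symm
    field_simp
    nlinarith

lemma edgePotential_nonneg {a w : ℝ} (hw : 0 ≤ w) (h : √w < a) : 0 ≤ edgePotential a w :=
  div_nonneg hw (sub_pos.2 h).le

/-- A bound on the potential keeps the distance away from the margin. -/
lemma exists_radius_of_edgePotential_le {a M : ℝ} (ha : 0 < a) (hM : 0 ≤ M) :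
    ∃ R, 0 ≤ R ∧ R < a ∧ ∀ r, 0 ≤ r → r < a → edgePotential a (r ^ 2) ≤ M → r ≤ R := by
  have hMa : 0 < M + a := by linarith
  have hδ : a ^ 2 / (4 * (M + a)) ≤ a / 4 := by
    rw [div_le_div_iff₀ (by positivity) (by positivity)]
    nlinarith [mul_nonneg hM ha.le]
  have hδ0 : 0 < a ^ 2 / (4 * (M + a)) := by positivity
  -- Were `a - r` smaller than `a²/(4(M + a)) ≤ a/4`, then `r² > a²/4 ≥ M (a - r)`, against the
  -- bound on the potential.
  refine ⟨a - a ^ 2 / (4 * (M + a)), by linarith, by linarith, fun r hr hra h => ?_⟩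
  by_contra! hlt
  rw [edgePotential, Real.sqrt_sq hr, div_le_iff₀ (sub_pos.2 hra)] at h
  have h1 : a - r < a ^ 2 / (4 * (M + a)) := by linarith
  have h2 : M * (a - r) ≤ M * (a ^ 2 / (4 * (M + a))) := by gcongr
  have h3 : M * (a ^ 2 / (4 * (M + a))) ≤ a ^ 2 / 4 := by
    rw [← mul_div_assoc, div_le_div_iff₀ (by positivity) (by positivity)]
    nlinarith [mul_nonneg (sq_nonneg a) ha.le]
  nlinarith

lemma weightFun_le {a r R : ℝ} (hr : 0 ≤ r) (hrR : r ≤ R) (hR : R < a) :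
    weightFun a r ≤ 1 / (a - R) + a * (1 / (a - R)) ^ 2 := by
  have h1 : 0 < a - R := sub_pos.2 hR
  have h2 : 0 < a - r := by linarith
  have ha : 0 < a := by linarith
  rw [weightFun_eq (by linarith)]
  gcongr

lemma abs_weightFun_sub_le {a r r' R : ℝ} (hr : 0 ≤ r) (hrR : r ≤ R) (hr' : r' ≤ R)
    (hR : R < a) :
    |weightFun a r - weightFun a r'| ≤
      (1 / (a - R)) ^ 2 * (1 + 2 * a * (1 / (a - R))) * |r - r'| := by
  have h1 : 0 < a - R := sub_pos.2 hR
  have h2 : 0 < a - r := by linarith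
  have h3 : 0 < a - r' := by linarith
  have ha : 0 < a := by linarith
  rw [weightFun_eq (by linarith), weightFun_eq (by linarith)]
  set u := 1 / (a - r) with hu
  set u' := 1 / (a - r') with hu'
  set U := 1 / (a - R) with hU
  have hu0 : 0 < u := by positivity
  have hu0' : 0 < u' := by positivity
  have huU : u ≤ U := by rw [hu, hU]; gcongr
  have huU' : u' ≤ U := by rw [hu', hU]; gcongr
  have hsub : u - u' = (r - r') * (u * u') := by
    rw [hu, hu']; field_simp; ring
  have : u + a * u ^ 2 - (u' + a * u' ^ 2) = (u * u') * (1 + a * (u + u')) * (r - r') := by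
    have : u + a * u ^ 2 - (u' + a * u' ^ 2) = (u - u') * (1 + a * (u + u')) := by ring
    rw [this, hsub]; ring
  rw [this, abs_mul, abs_of_nonneg (by positivity)]
  gcongr ?_ * ?_ * |r - r'|
  · rw [sq]; gcongr
  · have : a * (u + u') ≤ a * (U + U) := by gcongr
    linarith

end Potential

/-! ### Spectral gap of the graph and eigenvalues of `2 × 2` matrices -/

section Spectral

lemma minPosEigenvalue_le {m : Type*} [Fintype m] [DecidableEq m] {M : Matrix m m ℝ} {μ : ℝ}
    (hμ : 0 < μ) (h : μ ∈ spectrum ℝ M) : minPosEigenvalue M ≤ μ := by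
  refine csInf_le ⟨0, fun _ h => h.1.le⟩ ⟨hμ, ?_⟩
  have h' : Module.End.HasEigenvalue (Matrix.toLin' M) μ := by
    rwa [Module.End.hasEigenvalue_iff_mem_spectrum, Matrix.spectrum_toLin']
  convert h'

/-- Expand `u` in an orthonormal eigenbasis. Connectedness makes null vectors constant, hence
orthogonal to `u`; every other eigenvalue is at least the minimum positive one. -/
lemma minPosEigenvalue_mul_sum_sq_le {V : Type*} [Fintype V] [DecidableEq V] (G : SimpleGraph V)
    [DecidableRel G.Adj] (hG : G.Connected) (u : V → ℝ) (hu : ∑ i, u i = 0) :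
    minPosEigenvalue (G.lapMatrix ℝ) * ∑ i, u i ^ 2 ≤ u ⬝ᵥ (G.lapMatrix ℝ *ᵥ u) := by
  have hA := G.isHermitian_lapMatrix ℝ
  have hpsd := G.posSemidef_lapMatrix ℝ
  set b := hA.eigenvectorBasis with hb
  set c : V → ℝ := fun k => (b k).ofLp ⬝ᵥ u with hc
  have hsum : ∀ y : V → ℝ, u ⬝ᵥ y = ∑ k, c k * ((b k).ofLp ⬝ᵥ y) := fun y => by
    have := b.sum_inner_mul_inner (WithLp.toLp 2 u) (WithLp.toLp 2 y)
    simp only [EuclideanSpace.inner_eq_star_dotProduct, star_trivial] at this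
    rw [dotProduct_comm, ← this]
    refine Finset.sum_congr rfl fun k _ => ?_
    rw [dotProduct_comm y]
  have hL : ∀ k, (b k).ofLp ⬝ᵥ (G.lapMatrix ℝ *ᵥ u) = hA.eigenvalues k * c k := fun k => by
    rw [Matrix.dotProduct_mulVec, ← Matrix.mulVec_transpose, (G.isSymm_lapMatrix ℝ).eq,
      hb, hA.mulVec_eigenvectorBasis, smul_dotProduct, smul_eq_mul]
  have h1 : ∑ i, u i ^ 2 = ∑ k, c k ^ 2 := by
    have := hsum u
    simp only [sq]
    exact this
  rw [hsum, h1, Finset.mul_sum]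
  refine Finset.sum_le_sum fun k _ => ?_
  rw [hL]
  rcases (hpsd.eigenvalues_nonneg k).eq_or_lt with h0 | h0
  · have hk : G.lapMatrix ℝ *ᵥ (b k).ofLp = 0 := by
      rw [hb, hA.mulVec_eigenvectorBasis]
      change hA.eigenvalues k • _ = _
      rw [← (show 0 = hA.eigenvalues k from h0), zero_smul]
    rw [SimpleGraph.lapMatrix_mulVec_eq_zero_iff_forall_reachable] at hk
    have : c k = 0 := by
      have hcon : ∀ i, (b k).ofLp i = (b k).ofLp k := fun i => hk i k (hG.preconnected i k)
      simp only [hc, dotProduct, hcon]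
      rw [← Finset.mul_sum, hu, mul_zero]
    simp [this]
  · have := minPosEigenvalue_le h0 (hA.eigenvalues_mem_spectrum_real k)
    have hc2 := sq_nonneg (c k)
    calc _ ≤ hA.eigenvalues k * c k ^ 2 := by gcongr
      _ = _ := by ring

/-- Differences do not see the mean, so the previous bound applies to `u - m`, whose sum over pairs
is `2n` times its squared norm. -/
lemma poincare_scalar {V : Type*} [Fintype V] [Nonempty V] [DecidableEq V] (G : SimpleGraph V)
    [DecidableRel G.Adj] (hG : G.Connected) (u : V → ℝ) :
    minPosEigenvalue (G.lapMatrix ℝ) * ∑ i, ∑ j, (u i - u j) ^ 2 ≤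
      Fintype.card V * ∑ i, ∑ j, if G.Adj i j then (u i - u j) ^ 2 else 0 := by
  set m := (∑ i, u i) / Fintype.card V with hm
  have hn : (Fintype.card V : ℝ) ≠ 0 := by exact_mod_cast Fintype.card_ne_zero
  have h0 : ∑ i, (u i - m) = 0 := by
    rw [Finset.sum_sub_distrib, Finset.sum_const, Finset.card_univ, nsmul_eq_mul, hm]
    field_simp
    ring
  have h1 := minPosEigenvalue_mul_sum_sq_le G hG _ h0
  rw [← Matrix.toLinearMap₂'_apply', SimpleGraph.lapMatrix_toLinearMap₂'] at h1
  have h2 := sum_sum_inner_sub_sub (fun i => u i - m) (fun i => u i - m)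
  rw [h0] at h2
  simp only [sub_sub_sub_cancel_right, real_inner_self_eq_norm_sq, Real.norm_eq_abs, sq_abs,
    inner_zero_right, mul_zero, sub_zero] at h1 h2
  rw [h2]
  have hn0 : (0 : ℝ) ≤ Fintype.card V := by positivity
  nlinarith [mul_le_mul_of_nonneg_left h1 hn0]

lemma poincare {V : Type*} [Fintype V] [Nonempty V] [DecidableEq V] (G : SimpleGraph V)
    [DecidableRel G.Adj] (hG : G.Connected) {p : ℕ} (u : V → EuclideanSpace ℝ (Fin p)) :
    minPosEigenvalue (G.lapMatrix ℝ) * ∑ i, ∑ j, ‖u i - u j‖ ^ 2 ≤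
      Fintype.card V * ∑ i, ∑ j, if G.Adj i j then ‖u i - u j‖ ^ 2 else 0 := by
  have h1 : ∑ i, ∑ j, ‖u i - u j‖ ^ 2 = ∑ k, ∑ i, ∑ j, (u i k - u j k) ^ 2 := by
    simp only [EuclideanSpace.norm_sq_eq, Real.norm_eq_abs, sq_abs, PiLp.sub_apply]
    rw [Finset.sum_comm' (t' := Finset.univ) (s' := fun _ => Finset.univ) (by simp)]
    rw [Finset.sum_comm]
    conv_rhs => rw [Finset.sum_comm]
    refine Finset.sum_congr rfl fun i _ => ?_
    rw [Finset.sum_comm]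
  have h2 : (∑ i, ∑ j, if G.Adj i j then ‖u i - u j‖ ^ 2 else 0) =
      ∑ k, ∑ i, ∑ j, if G.Adj i j then (u i k - u j k) ^ 2 else 0 := by
    conv_rhs => rw [Finset.sum_comm]
    refine Finset.sum_congr rfl fun i _ => ?_
    rw [Finset.sum_comm]
    refine Finset.sum_congr rfl fun j _ => ?_
    split_ifs
    · simp only [EuclideanSpace.norm_sq_eq, Real.norm_eq_abs, sq_abs, PiLp.sub_apply]
    · simp
  rw [h1, h2, Finset.mul_sum, Finset.mul_sum]
  exact Finset.sum_le_sum fun k _ => poincare_scalar G hG _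

lemma le_spectralRadius_toReal {m : Type*} [Fintype m] [DecidableEq m] {M : Matrix m m ℝ} {μ : ℝ}
    (h : μ ∈ spectrum ℝ M) : μ ≤ (spectralRadius ℝ M).toReal := by
  -- Finiteness is needed because `toReal` would send `⊤` to `0`.
  have hfin : spectralRadius ℝ M ≠ ⊤ := by
    obtain ⟨C, hC⟩ := (Matrix.finite_spectrum M).isBounded.exists_norm_le
    refine ne_top_of_le_ne_top (ENNReal.coe_ne_top (r := C.toNNReal)) ?_
    refine iSup₂_le fun k hk => ENNReal.coe_le_coe.2 ?_
    rw [← NNReal.coe_le_coe, coe_nnnorm]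
    exact (hC k hk).trans (Real.le_coe_toNNReal C)
  have h1 : (‖μ‖₊ : ENNReal) ≤ spectralRadius ℝ M :=
    le_iSup₂ (f := fun k (_ : k ∈ spectrum ℝ M) => (‖k‖₊ : ENNReal)) μ h
  have h2 := ENNReal.toReal_mono hfin h1
  simp only [ENNReal.coe_toReal, coe_nnnorm, Real.norm_eq_abs] at h2
  exact (le_abs_self μ).trans h2

/-- The largest eigenvalue of a symmetric positive definite `2 × 2` matrix. -/
lemma exists_max_eigenvalue_fin_two {a b c : ℝ} (ha : 0 < a) :
    ∃ l, 0 < l ∧ a ≤ l ∧ c ≤ l ∧ b ^ 2 ≤ (l - a) * (l - c) ∧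
      l ≤ (spectralRadius ℝ !![a, b; b, c]).toReal := by
  set s := √((a - c) ^ 2 + 4 * b ^ 2) with hs
  have hs2 : s ^ 2 = (a - c) ^ 2 + 4 * b ^ 2 := Real.sq_sqrt (by positivity)
  have habs : |a - c| ≤ s := Real.abs_le_sqrt (by nlinarith [sq_nonneg b])
  have h1 := (abs_le.1 habs).1
  have h2 := (abs_le.1 habs).2
  have hs0 : 0 ≤ s := Real.sqrt_nonneg _
  have hdet : ((a + c + s) / 2 - a) * ((a + c + s) / 2 - c) = b ^ 2 := by
    nlinarith
  -- The larger root of the characteristic polynomial; the determinant condition holds with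
  -- equality.
  refine ⟨(a + c + s) / 2, by linarith, by linarith, by linarith, hdet.ge, ?_⟩
  apply le_spectralRadius_toReal
  rw [spectrum.mem_iff, Matrix.isUnit_iff_isUnit_det, Matrix.det_fin_two]
  simp [Matrix.algebraMap_matrix_apply]
  linarith

lemma two_by_two_posSemidef {a b c : ℝ} (h : (!![a, b; b, c] : Matrix (Fin 2) (Fin 2) ℝ).PosSemidef) :
    0 ≤ a ∧ 0 ≤ c ∧ b ^ 2 ≤ a * c := by
  refine ⟨?_, ?_, ?_⟩
  · simpa using h.diag_nonneg (i := 0)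
  · simpa using h.diag_nonneg (i := 1)
  · have := h.det_nonneg
    rw [Matrix.det_fin_two] at this
    simp at this
    linarith

end Spectral

/-! ### Weights, feedbacks and the perturbed closed loop -/

section Feedback

variable {V : Type*} {p : ℕ} {N : Network V p} {τ : V → EuclideanSpace ℝ (Fin p)}

lemma weight_of_adj {i j : V} (h : N.graph.Adj i j) (x : V → EuclideanSpace ℝ (Fin p)) :
    N.weight x i j = weightFun (N.Δ - ‖N.d i j‖) ‖x i - x j - N.d i j‖ := by
  rw [Network.weight, if_pos h, weightFun]
  ring

lemma weight_of_not_adj {i j : V} (h : ¬ N.graph.Adj i j) (x : V → EuclideanSpace ℝ (Fin p)) :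
    N.weight x i j = 0 := by
  rw [Network.weight, if_neg h]

lemma displacement_neg (hτ : ∀ i j, N.graph.Adj i j → τ i - τ j = N.d i j) {i j : V}
    (h : N.graph.Adj i j) : N.d j i = -N.d i j := by
  rw [← hτ i j h, ← hτ j i h.symm, neg_sub]

lemma weight_comm (hτ : ∀ i j, N.graph.Adj i j → τ i - τ j = N.d i j)
    (x : V → EuclideanSpace ℝ (Fin p)) (i j : V) : N.weight x i j = N.weight x j i := by
  by_cases h : N.graph.Adj i j
  · rw [weight_of_adj h, weight_of_adj h.symm, displacement_neg hτ h, norm_neg,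
      ← norm_neg (x i - x j - N.d i j)]
    congr 2
    abel
  · rw [weight_of_not_adj h, weight_of_not_adj fun h' => h h'.symm]

lemma weight_nonneg {x : V → EuclideanSpace ℝ (Fin p)} (hx : N.InitialOK x) (i j : V) :
    0 ≤ N.weight x i j := by
  by_cases h : N.graph.Adj i j
  · rw [weight_of_adj h]
    exact weightFun_nonneg (norm_nonneg _) (hx i j h)
  · rw [weight_of_not_adj h]

/-- Feasibility absorbs the displacements into the shifted positions `x - τ`; off the edges both
sides vanish. -/
lemma weight_smul_sub (hτ : ∀ i j, N.graph.Adj i j → τ i - τ j = N.d i j)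
    (x : V → EuclideanSpace ℝ (Fin p)) (i j : V) :
    N.weight x i j • (x i - x j - N.d i j) =
      N.weight x i j • ((x i - τ i) - (x j - τ j)) := by
  by_cases h : N.graph.Adj i j
  · rw [← hτ i j h]
    congr 1
    abel
  · simp [weight_of_not_adj h]

lemma weight_mul_inner (hτ : ∀ i j, N.graph.Adj i j → τ i - τ j = N.d i j)
    (x : V → EuclideanSpace ℝ (Fin p)) (i j : V) (y : EuclideanSpace ℝ (Fin p)) :
    N.weight x i j * inner ℝ (x i - x j - N.d i j) y =
      N.weight x i j * inner ℝ ((x i - τ i) - (x j - τ j)) y := by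
  rw [← real_inner_smul_left, weight_smul_sub hτ, real_inner_smul_left]

variable [Fintype V]

lemma posFeedback_eq (hτ : ∀ i j, N.graph.Adj i j → τ i - τ j = N.d i j)
    (x : V → EuclideanSpace ℝ (Fin p)) (i : V) :
    N.posFeedback x i = ∑ j, N.weight x i j • ((x i - τ i) - (x j - τ j)) :=
  Finset.sum_congr rfl fun j _ => weight_smul_sub hτ x i j

/-- The closed loop on `[0, b]`: the event-triggered sampling acts as a perturbation `e` of the
feedback that decays like the threshold. -/
structure IsClosedLoop (N : Network V p) (g : Gains) (b : ℝ)
    (x q e : ℝ → V → EuclideanSpace ℝ (Fin p)) : Prop where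
  cont_x : ∀ i, ContinuousOn (fun t => x t i) (Set.Icc 0 b)
  cont_q : ∀ i, ContinuousOn (fun t => q t i) (Set.Icc 0 b)
  deriv_x : ∀ i, ∀ t ∈ Set.Ico 0 b, HasDerivWithinAt (fun r => x r i) (q t i) (Set.Ici t) t
  deriv_q : ∀ i, ∀ t ∈ Set.Ico 0 b, HasDerivWithinAt (fun r => q r i)
    (-(g.k₁ • N.posFeedback (x t) i) - g.k₂ • N.velFeedback (x t) (q t) i - g.k₃ • q t i + e t i)
    (Set.Ici t) t
  err : ∀ i, ∀ t ∈ Set.Ico 0 b, ‖e t i‖ ≤ g.α * Real.exp (-g.β * t)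

lemma IsClosedLoop.mono {g : Gains} {b b' : ℝ} {x q e : ℝ → V → EuclideanSpace ℝ (Fin p)}
    (h : IsClosedLoop N g b x q e) (hb : b' ≤ b) : IsClosedLoop N g b' x q e where
  cont_x i := (h.cont_x i).mono (Set.Icc_subset_Icc_right hb)
  cont_q i := (h.cont_q i).mono (Set.Icc_subset_Icc_right hb)
  deriv_x i t ht := h.deriv_x i t (Set.Ico_subset_Ico_right hb ht)
  deriv_q i t ht := h.deriv_q i t (Set.Ico_subset_Ico_right hb ht)
  err i t ht := h.err i t (Set.Ico_subset_Ico_right hb ht)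

end Feedback

/-! ### The last triggering time -/

section Triggers

lemma lastTrigger_mem {S : Set ℝ} {t : ℝ} (h0 : (0 : ℝ) ∈ S) (ht : 0 ≤ t)
    (hS : (S ∩ Set.Iic t).Finite) : lastTrigger S t ∈ S ∩ Set.Iic t :=
  Set.Nonempty.csSup_mem ⟨0, h0, ht⟩ hS

lemma le_lastTrigger {S : Set ℝ} {t r : ℝ} (hr : r ∈ S) (hrt : r ≤ t) : r ≤ lastTrigger S t :=
  le_csSup ⟨t, fun _ h => h.2⟩ ⟨hr, hrt⟩

lemma lastTrigger_eq {S : Set ℝ} {s t : ℝ} (hs : s ∈ S) (hst : s ≤ t)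
    (h : ∀ r ∈ S, s < r → t < r) : lastTrigger S t = s :=
  le_antisymm (csSup_le ⟨s, hs, hst⟩ fun r hr => not_lt.1 fun hsr =>
    (h r hr.1 hsr).not_ge hr.2) (le_lastTrigger hs hst)

end Triggers

/-! ### Executions as perturbed closed loops -/

section Execution

variable {V : Type*} [Fintype V] {p : ℕ} {N : Network V p} {g : Gains} {T : EReal}
  {x q : ℝ → V → EuclideanSpace ℝ (Fin p)} {S : V → Set ℝ}

/-- The held input is the current feedback plus the measurement error, which thus acts as an
additive disturbance. -/
lemma controlInput_eq (i : V) (R : Set ℝ) (t : ℝ) :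
    controlInput N g x q R i t =
      -(g.k₁ • N.posFeedback (x t) i) - g.k₂ • N.velFeedback (x t) (q t) i - g.k₃ • q t i +
        triggerError N g x q i (lastTrigger R t) t := by
  rw [controlInput, triggerError]
  module

lemma IsExecution.lastTrigger_mem (h : IsExecution N g T x q S) (i : V) {t : ℝ} (ht : 0 ≤ t)
    (htT : (t : EReal) < T) : lastTrigger (S i) t ∈ S i ∩ Set.Iic t :=
  FormationControl.lastTrigger_mem (h.zero_mem i) ht (h.finite i t htT)

lemma IsExecution.isClosedLoop (h : IsExecution N g T x q S) {b : ℝ} (hb : (b : EReal) < T) :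
    IsClosedLoop N g b x q (fun t i => triggerError N g x q i (lastTrigger (S i) t) t) where
  cont_x i t ht := ((h.deriv_x i t ht.1
    (lt_of_le_of_lt (EReal.coe_le_coe_iff.2 ht.2) hb)).continuousWithinAt).mono
      Set.Icc_subset_Ici_self
  cont_q i := (h.cont_q i).mono fun t ht =>
    ⟨ht.1, lt_of_le_of_lt (EReal.coe_le_coe_iff.2 ht.2) hb⟩
  deriv_x i t ht := (h.deriv_x i t ht.1
    (lt_trans (EReal.coe_lt_coe_iff.2 ht.2) hb)).mono (Set.Ici_subset_Ici.2 ht.1)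
  deriv_q i t ht := by
    rw [← controlInput_eq]
    exact h.deriv_q i t ht.1 (lt_trans (EReal.coe_lt_coe_iff.2 ht.2) hb)
  err i t ht := by
    have htT : (t : EReal) < T := lt_trans (EReal.coe_lt_coe_iff.2 ht.2) hb
    have hm := h.lastTrigger_mem i ht.1 htT
    exact h.bound i _ hm.1 t hm.2 htT fun r hr hlt =>
      le_of_lt (not_le.1 fun hrt => (le_lastTrigger hr hrt).not_gt hlt)

end Execution

/-! ### Bounded energy and connectivity preservation -/

section Energy

variable {V : Type*} [Fintype V] {p : ℕ} {N : Network V p} {g : Gains}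
  {τ : V → EuclideanSpace ℝ (Fin p)} {x q e : ℝ → V → EuclideanSpace ℝ (Fin p)} {b : ℝ}

/-- The energy that bounds the distances between neighbours. -/
def Network.energy (N : Network V p) (g : Gains) (x q : V → EuclideanSpace ℝ (Fin p)) : ℝ :=
  open Classical in
  g.k₁ / 2 * (∑ i, ∑ j, if N.graph.Adj i j then
      edgePotential (N.Δ - ‖N.d i j‖) (‖x i - x j - N.d i j‖ ^ 2) else 0) +
    1 / 2 * ∑ i, ‖q i‖ ^ 2

lemma hasDerivWithinAt_edgePotential_norm_sq {F : Type*} [NormedAddCommGroup F]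
    [InnerProductSpace ℝ F] {f : ℝ → F} {f' : F} {s : Set ℝ} {t a : ℝ}
    (hf : HasDerivWithinAt f f' s t) (ha : ‖f t‖ < a) :
    HasDerivWithinAt (fun r => edgePotential a (‖f r‖ ^ 2))
      (weightFun a ‖f t‖ * inner ℝ (f t) f') s t := by
  have h := (hasDerivAt_edgePotential (a := a) (w := ‖f t‖ ^ 2) (sq_nonneg _)
    (by rwa [Real.sqrt_sq (norm_nonneg _)])).comp_hasDerivWithinAt t hf.norm_sq
  refine h.congr_deriv ?_
  rw [Real.sqrt_sq (norm_nonneg _)]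
  ring

lemma continuousAt_edgePotential {a w : ℝ} (hw : 0 ≤ w) (h : √w < a) :
    ContinuousAt (edgePotential a) w :=
  (hasDerivAt_edgePotential hw h).continuousAt

/-- The position feedback is the gradient of the potential part, so its work on the velocities
cancels the derivative of the potentials. -/
lemma IsClosedLoop.hasDerivWithinAt_energy (h : IsClosedLoop N g b x q e)
    (hτ : ∀ i j, N.graph.Adj i j → τ i - τ j = N.d i j) {t : ℝ} (ht : t ∈ Set.Ico 0 b)
    (hx : N.InitialOK (x t)) :
    HasDerivWithinAt (fun r => N.energy g (x r) (q r))
      (∑ i, (-(g.k₂ * inner ℝ (q t i) (N.velFeedback (x t) (q t) i)) - g.k₃ * ‖q t i‖ ^ 2 +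
        inner ℝ (q t i) (e t i))) (Set.Ici t) t := by
  classical
  have h1 : ∀ i j, HasDerivWithinAt (fun r => if N.graph.Adj i j then
      edgePotential (N.Δ - ‖N.d i j‖) (‖x r i - x r j - N.d i j‖ ^ 2) else 0)
      (N.weight (x t) i j * inner ℝ ((x t i - τ i) - (x t j - τ j)) (q t i - q t j))
      (Set.Ici t) t := fun i j => by
    by_cases hij : N.graph.Adj i j
    · simp only [if_pos hij]
      rw [← weight_mul_inner hτ, weight_of_adj hij]
      exact hasDerivWithinAt_edgePotential_norm_sq
        (((h.deriv_x i t ht).sub (h.deriv_x j t ht)).sub_const _) (hx i j hij)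
    · simp only [if_neg hij, weight_of_not_adj hij, zero_mul]
      exact hasDerivWithinAt_const _ _ _
  have h2 := (HasDerivWithinAt.fun_sum fun i (_ : i ∈ Finset.univ) =>
    HasDerivWithinAt.fun_sum fun j (_ : j ∈ Finset.univ) => h1 i j).const_mul (g.k₁ / 2)
  have h3 := (HasDerivWithinAt.fun_sum fun i (_ : i ∈ Finset.univ) =>
    (h.deriv_q i t ht).norm_sq).const_mul (1 / 2)
  refine (h2.add h3).congr_deriv ?_
  have h4 := two_mul_sum_inner_sum_smul_sub (N.weight (x t)) (weight_comm hτ _) (q t)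
    (fun i => x t i - τ i)
  have h5 : ∑ i, ∑ j, N.weight (x t) i j *
      inner ℝ ((x t i - τ i) - (x t j - τ j)) (q t i - q t j) =
      2 * ∑ i, inner ℝ (q t i) (N.posFeedback (x t) i) := by
    simp only [posFeedback_eq hτ]
    rw [h4]
    simp only [real_inner_comm]
  rw [h5, Finset.mul_sum, Finset.mul_sum, Finset.mul_sum, ← Finset.sum_add_distrib]
  refine Finset.sum_congr rfl fun i _ => ?_
  simp only [inner_add_right, inner_sub_right, inner_neg_right, real_inner_smul_right,
    real_inner_self_eq_norm_sq]
  ring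

lemma sum_inner_velFeedback_nonneg (hτ : ∀ i j, N.graph.Adj i j → τ i - τ j = N.d i j)
    {y v : V → EuclideanSpace ℝ (Fin p)} (hy : N.InitialOK y) :
    0 ≤ ∑ i, inner ℝ (v i) (N.velFeedback y v i) := by
  have h := two_mul_sum_inner_sum_smul_sub (N.weight y) (weight_comm hτ y) v v
  have : 0 ≤ ∑ i, ∑ j, N.weight y i j * inner ℝ (v i - v j) (v i - v j) :=
    Finset.sum_nonneg fun i _ => Finset.sum_nonneg fun j _ =>
      mul_nonneg (weight_nonneg hy i j) real_inner_self_nonneg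
  rw [← h] at this
  simpa [Network.velFeedback] using this

/-- By Young's inequality `⟨q, e⟩ ≤ k₃ ‖q‖² + ‖e‖²/(4k₃)`, and the last term is integrable in time;
the velocity feedback only dissipates. -/
lemma IsClosedLoop.energy_le (h : IsClosedLoop N g b x q e)
    (hτ : ∀ i j, N.graph.Adj i j → τ i - τ j = N.d i j) (hk₂ : 0 < g.k₂) (hk₃ : 0 < g.k₃)
    (hβ : 0 < g.β) (hx : ∀ t ∈ Set.Icc 0 b, N.InitialOK (x t)) {t : ℝ} (ht : t ∈ Set.Icc 0 b) :
    N.energy g (x t) (q t) ≤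
      N.energy g (x 0) (q 0) + Fintype.card V * g.α ^ 2 / (4 * g.k₃) / (2 * g.β) := by
  classical
  set C := Fintype.card V * g.α ^ 2 / (4 * g.k₃) with hC
  have hC0 : 0 ≤ C := by positivity
  have hcont : ContinuousOn (fun r => N.energy g (x r) (q r)) (Set.Icc 0 b) := by
    refine ContinuousOn.add (continuousOn_const.mul ?_) (continuousOn_const.mul ?_)
    · refine continuousOn_finsetSum _ fun i _ => continuousOn_finsetSum _ fun j _ => ?_
      by_cases hij : N.graph.Adj i j
      · simp only [if_pos hij]
        intro s hs
        have hc : ContinuousWithinAt (fun r => ‖x r i - x r j - N.d i j‖ ^ 2) (Set.Icc 0 b) s :=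
          ((((h.cont_x i).sub (h.cont_x j)).sub continuousOn_const).norm.pow 2) s hs
        exact ContinuousAt.comp_continuousWithinAt (f := fun r => ‖x r i - x r j - N.d i j‖ ^ 2)
          (continuousAt_edgePotential (sq_nonneg _)
            (by rw [Real.sqrt_sq (norm_nonneg _)]; exact hx s hs i j hij)) hc
      · simp only [if_neg hij]
        exact continuousOn_const
    · exact continuousOn_finsetSum _ fun i _ => (h.cont_q i).norm.pow 2
  -- The barrier is the initial energy plus the integral of `C e^{-2βs}`.
  have hB : ∀ s : ℝ, HasDerivAt (fun s => N.energy g (x 0) (q 0) +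
      C / (2 * g.β) * (1 - Real.exp (-(2 * g.β) * s))) (C * Real.exp (-(2 * g.β) * s)) s := by
    intro s
    have := ((((hasDerivAt_id s).const_mul (-(2 * g.β))).exp.const_sub 1).const_mul
      (C / (2 * g.β))).const_add (N.energy g (x 0) (q 0))
    refine this.congr_deriv ?_
    simp only [id]
    field_simp
  have key := image_le_of_deriv_right_le_deriv_boundary hcont
    (fun s hs => h.hasDerivWithinAt_energy hτ hs (hx s (Set.Ico_subset_Icc_self hs)))
    (B := fun s => N.energy g (x 0) (q 0) + C / (2 * g.β) * (1 - Real.exp (-(2 * g.β) * s)))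
    (by simp) (fun s _ => (hB s).continuousAt.continuousWithinAt)
    (fun s _ => (hB s).hasDerivWithinAt) ?_ ht
  · refine key.trans ?_
    have := Real.exp_pos (-(2 * g.β) * t)
    have h2 : C / (2 * g.β) * (1 - Real.exp (-(2 * g.β) * t)) ≤ C / (2 * g.β) * 1 := by
      gcongr; linarith
    simpa using h2
  · intro s hs
    have hs0 := sum_inner_velFeedback_nonneg (v := q s) hτ (hx s (Set.Ico_subset_Icc_self hs))
    have hi : ∀ i, -(g.k₃ * ‖q s i‖ ^ 2) + inner ℝ (q s i) (e s i) ≤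
        g.α ^ 2 / (4 * g.k₃) * Real.exp (-(2 * g.β) * s) := fun i => by
      have he := h.err i s hs
      have h1 : ‖e s i‖ ^ 2 ≤ g.α ^ 2 * Real.exp (-(2 * g.β) * s) := by
        calc ‖e s i‖ ^ 2 ≤ (g.α * Real.exp (-g.β * s)) ^ 2 := by gcongr
          _ = _ := by rw [mul_pow, ← Real.exp_nat_mul]; congr 2; push_cast; ring
      have h2 := real_inner_le_norm (q s i) (e s i)
      have h3 : -(g.k₃ * ‖q s i‖ ^ 2) + ‖q s i‖ * ‖e s i‖ ≤ ‖e s i‖ ^ 2 / (4 * g.k₃) := by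
        rw [le_div_iff₀ (by positivity)]
        nlinarith [sq_nonneg (2 * g.k₃ * ‖q s i‖ - ‖e s i‖)]
      calc _ ≤ ‖e s i‖ ^ 2 / (4 * g.k₃) := by linarith
        _ ≤ g.α ^ 2 * Real.exp (-(2 * g.β) * s) / (4 * g.k₃) := by gcongr
        _ = _ := by ring
    calc _ = -(g.k₂ * ∑ i, inner ℝ (q s i) (N.velFeedback (x s) (q s) i)) +
          ∑ i, (-(g.k₃ * ‖q s i‖ ^ 2) + inner ℝ (q s i) (e s i)) := by
            rw [Finset.mul_sum, ← Finset.sum_neg_distrib, ← Finset.sum_add_distrib]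
            refine Finset.sum_congr rfl fun i _ => ?_
            ring
      _ ≤ 0 + ∑ _i : V, g.α ^ 2 / (4 * g.k₃) * Real.exp (-(2 * g.β) * s) :=
          add_le_add (neg_nonpos.2 (mul_nonneg hk₂.le hs0)) (Finset.sum_le_sum fun i _ => hi i)
      _ = _ := by
          rw [Finset.sum_const, Finset.card_univ, nsmul_eq_mul, hC]
          ring

lemma edgePotential_le_of_energy_le {M : ℝ} (hk₁ : 0 < g.k₁)
    {y v : V → EuclideanSpace ℝ (Fin p)} (hy : N.InitialOK y) (hM : N.energy g y v ≤ M) {i j : V}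
    (hij : N.graph.Adj i j) :
    edgePotential (N.Δ - ‖N.d i j‖) (‖y i - y j - N.d i j‖ ^ 2) ≤ 2 * M / g.k₁ := by
  classical
  set f : V → V → ℝ := fun i j => if N.graph.Adj i j then
      edgePotential (N.Δ - ‖N.d i j‖) (‖y i - y j - N.d i j‖ ^ 2) else 0 with hf
  have hf0 : ∀ i j, 0 ≤ f i j := fun i j => by
    simp only [hf]
    split_ifs with h
    · exact edgePotential_nonneg (sq_nonneg _)
        (by rw [Real.sqrt_sq (norm_nonneg _)]; exact hy i j h)
    · exact le_rfl
  have h1 : f i j ≤ ∑ i, ∑ j, f i j :=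
    (Finset.single_le_sum (fun j _ => hf0 i j) (Finset.mem_univ j)).trans
      (Finset.single_le_sum (f := fun i => ∑ j, f i j)
        (fun i _ => Finset.sum_nonneg fun j _ => hf0 i j) (Finset.mem_univ i))
  have h2 : 0 ≤ ∑ i, ‖v i‖ ^ 2 := by positivity
  have h3 : f i j = edgePotential (N.Δ - ‖N.d i j‖) (‖y i - y j - N.d i j‖ ^ 2) := by
    simp only [hf, if_pos hij]
  have h4 : N.energy g y v = g.k₁ / 2 * (∑ i, ∑ j, f i j) + 1 / 2 * ∑ i, ‖v i‖ ^ 2 := rfl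
  rw [← h3, le_div_iff₀ hk₁]
  have h5 : g.k₁ / 2 * (∑ i, ∑ j, f i j) ≤ M := by linarith
  nlinarith

/-- The distances between neighbours stay uniformly inside the admissible range. -/
lemma exists_radius (hτ : ∀ i j, N.graph.Adj i j → τ i - τ j = N.d i j)
    (hd : ∀ i j, N.graph.Adj i j → ‖N.d i j‖ < N.Δ)
    (hk₁ : 0 < g.k₁) (hk₂ : 0 < g.k₂) (hk₃ : 0 < g.k₃) (hβ : 0 < g.β)
    (x₀ q₀ : V → EuclideanSpace ℝ (Fin p)) (hx₀ : N.InitialOK x₀) :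
    ∃ R : V → V → ℝ, (∀ i j, N.graph.Adj i j → R i j < N.Δ - ‖N.d i j‖) ∧
      ∀ (b : ℝ) (x q e : ℝ → V → EuclideanSpace ℝ (Fin p)), IsClosedLoop N g b x q e →
        x 0 = x₀ → q 0 = q₀ → ∀ t ∈ Set.Icc 0 b, ∀ i j, N.graph.Adj i j →
          ‖x t i - x t j - N.d i j‖ ≤ R i j := by
  set M := N.energy g x₀ q₀ + Fintype.card V * g.α ^ 2 / (4 * g.k₃) / (2 * g.β) with hM
  have hR : ∀ i j, ∃ R, N.graph.Adj i j → 0 ≤ R ∧ R < N.Δ - ‖N.d i j‖ ∧ ∀ r, 0 ≤ r →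
      r < N.Δ - ‖N.d i j‖ → edgePotential (N.Δ - ‖N.d i j‖) (r ^ 2) ≤ |2 * M / g.k₁| → r ≤ R := by
    intro i j
    by_cases hij : N.graph.Adj i j
    · obtain ⟨R, h⟩ := exists_radius_of_edgePotential_le (sub_pos.2 (hd i j hij))
        (abs_nonneg (2 * M / g.k₁))
      exact ⟨R, fun _ => h⟩
    · exact ⟨0, fun h => absurd h hij⟩
  choose R hR using hR
  refine ⟨R, fun i j hij => (hR i j hij).2.1, fun b x q e h hx hq => ?_⟩
  -- The energy bound presupposes admissible configurations, but then returns the stricter radius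
  -- `R`; a first-exit argument closes the circle.
  have good : ∀ s ≤ b, (∀ t ∈ Set.Icc 0 s, N.InitialOK (x t)) → ∀ t ∈ Set.Icc 0 s, ∀ i j,
      N.graph.Adj i j → ‖x t i - x t j - N.d i j‖ ≤ R i j := by
    intro s hs hok t ht i j hij
    have h1 := (h.mono hs).energy_le hτ hk₂ hk₃ hβ hok ht
    rw [hx, hq, ← hM] at h1
    exact (hR i j hij).2.2 _ (norm_nonneg _) (hok t ht i j hij)
      ((edgePotential_le_of_energy_le hk₁ (hok t ht) h1 hij).trans (le_abs_self _))
  refine good b le_rfl ?_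
  by_contra! hbad
  obtain ⟨t₁, ht₁, hbad⟩ := hbad
  have hcont : ∀ i j, ContinuousOn (fun t => ‖x t i - x t j - N.d i j‖) (Set.Icc 0 b) :=
    fun i j => (((h.cont_x i).sub (h.cont_x j)).sub continuousOn_const).norm
  -- The closed set of times at which some edge is not admissible; its infimum is the first exit
  -- time.
  set Z : Set ℝ := ⋃ ij ∈ {ij : V × V | N.graph.Adj ij.1 ij.2}, Set.Icc 0 b ∩
    (fun t => ‖x t ij.1 - x t ij.2 - N.d ij.1 ij.2‖) ⁻¹' Set.Ici (N.Δ - ‖N.d ij.1 ij.2‖) with hZ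
  have hZc : IsClosed Z := (Set.toFinite _).isClosed_biUnion fun ij _ =>
    (hcont ij.1 ij.2).preimage_isClosed_of_isClosed isClosed_Icc isClosed_Ici
  have hZ1 : ∀ t ∈ Set.Icc 0 b, t ∉ Z → N.InitialOK (x t) := by
    intro t ht htZ i j hij
    by_contra! hlt
    exact htZ (Set.mem_biUnion (x := (i, j)) hij ⟨ht, hlt⟩)
  have hZb : Z ⊆ Set.Icc 0 b := Set.iUnion₂_subset fun _ _ => Set.inter_subset_left
  have hbdd : BddBelow Z := ⟨0, fun t ht => (hZb ht).1⟩
  have hmem : sInf Z ∈ Z := hZc.csInf_mem ⟨t₁, by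
    by_contra hn
    exact hbad (hZ1 t₁ ht₁ hn)⟩ hbdd
  have hs0 := hZb hmem
  set s := sInf Z with hs
  obtain ⟨⟨i, j⟩, hij, -, hle⟩ := Set.mem_iUnion₂.1 hmem
  have hij : N.graph.Adj i j := hij
  have hle : N.Δ - ‖N.d i j‖ ≤ ‖x s i - x s j - N.d i j‖ := hle
  have hpos : 0 < s := by
    refine lt_of_le_of_ne hs0.1 fun h0 => ?_
    rw [← h0, hx] at hle
    exact hle.not_gt (hx₀ i j hij)
  have hlt : ∀ t ∈ Set.Ico 0 s, ‖x t i - x t j - N.d i j‖ ≤ R i j := fun t ht =>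
    good t (ht.2.le.trans hs0.2) (fun r hr => hZ1 r ⟨hr.1, hr.2.trans (ht.2.le.trans hs0.2)⟩
      fun hrZ => (csInf_le hbdd hrZ).not_gt (hr.2.trans_lt ht.2)) t ⟨ht.1, le_rfl⟩ i j hij
  -- The bound by `R` before the exit time passes to the limit, where the distance would have to be
  -- at least the margin.
  have hcl : ‖x s i - x s j - N.d i j‖ ≤ R i j := by
    have h1 : ContinuousWithinAt (fun t => ‖x t i - x t j - N.d i j‖) (Set.Ico 0 s) s :=
      (hcont i j s hs0).mono fun t ht => ⟨ht.1, ht.2.le.trans hs0.2⟩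
    have hne : (𝓝[Set.Ico 0 s] s).NeBot := by
      rw [← mem_closure_iff_nhdsWithin_neBot, closure_Ico hpos.ne]
      exact ⟨hpos.le, le_rfl⟩
    exact le_of_tendsto h1 (eventually_nhdsWithin_of_forall hlt)
  exact (hle.trans hcl).not_gt (hR i j hij).2.1

end Energy

/-! ### Consequences of the conditions on the gains -/

section Parameters

variable {V : Type*} [Fintype V] {p : ℕ} {N : Network V p}

/-- The weighted Laplacian of an admissible configuration dominates `β₁` on disagreements. -/
lemma weighted_poincare [Nontrivial V] (hconn : N.graph.Connected)
    (hd : ∀ i j, N.graph.Adj i j → ‖N.d i j‖ < N.Δ) {β₁ : ℝ} (hβ₁ : 0 < β₁) (hβ₁' : β₁ ≤ N.β₀)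
    {y : V → EuclideanSpace ℝ (Fin p)} (hy : N.InitialOK y) (u : V → EuclideanSpace ℝ (Fin p)) :
    β₁ * ∑ i, ∑ j, ‖u i - u j‖ ^ 2 ≤
      Fintype.card V * ∑ i, ∑ j, N.weight y i j * ‖u i - u j‖ ^ 2 := by
  classical
  have hle : ∀ i j, N.graph.Adj i j → N.Δ - ‖N.d i j‖ ≤ N.Δ₀ := fun i j hij => by
    refine le_csSup ⟨N.Δ, ?_⟩ ⟨i, j, hij, rfl⟩
    rintro r ⟨i, j, -, rfl⟩
    linarith [norm_nonneg (N.d i j)]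
  have hΔ₀ : 0 < N.Δ₀ := by
    obtain ⟨i⟩ := (inferInstance : Nonempty V)
    obtain ⟨j, hij⟩ := hconn.preconnected.exists_adj_of_nontrivial i
    exact (sub_pos.2 (hd i j hij)).trans_le (hle i j hij)
  have hpo := poincare N.graph hconn u
  have hw : ∀ i j, (1 / N.Δ₀) * (if N.graph.Adj i j then ‖u i - u j‖ ^ 2 else 0) ≤
      N.weight y i j * ‖u i - u j‖ ^ 2 := fun i j => by
    by_cases hij : N.graph.Adj i j
    · rw [if_pos hij, weight_of_adj hij]
      have h1 := two_div_le_weightFun (norm_nonneg _) (hy i j hij)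
      have h0 : 0 < N.Δ - ‖N.d i j‖ := sub_pos.2 (hd i j hij)
      -- The weight is even at least `2/Δ₀`; since `β₁ Δ₀ ≤ ρ₂(L)`, half of that suffices.
      have h2 : 1 / N.Δ₀ ≤ 2 / (N.Δ - ‖N.d i j‖) :=
        div_le_div₀ (by norm_num) (by norm_num) h0 (hle i j hij)
      gcongr
      exact h2.trans h1
    · simp [if_neg hij, weight_of_not_adj hij]
  have hρ : β₁ * N.Δ₀ ≤ minPosEigenvalue (N.graph.lapMatrix ℝ) := by
    have h1 : N.β₀ = minPosEigenvalue (N.graph.lapMatrix ℝ) / N.Δ₀ := by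
      rw [Network.β₀]
    rw [h1, le_div_iff₀ hΔ₀] at hβ₁'
    exact hβ₁'
  have hs : 0 ≤ ∑ i, ∑ j, ‖u i - u j‖ ^ 2 := by positivity
  calc β₁ * ∑ i, ∑ j, ‖u i - u j‖ ^ 2
      = (1 / N.Δ₀) * (β₁ * N.Δ₀ * ∑ i, ∑ j, ‖u i - u j‖ ^ 2) := by field_simp
    _ ≤ (1 / N.Δ₀) * (minPosEigenvalue (N.graph.lapMatrix ℝ) * ∑ i, ∑ j, ‖u i - u j‖ ^ 2) := by
        gcongr
    _ ≤ (1 / N.Δ₀) * (Fintype.card V *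
          ∑ i, ∑ j, if N.graph.Adj i j then ‖u i - u j‖ ^ 2 else 0) := by gcongr
    _ = Fintype.card V * ∑ i, ∑ j, (1 / N.Δ₀) *
          (if N.graph.Adj i j then ‖u i - u j‖ ^ 2 else 0) := by
        simp only [← Finset.mul_sum]
        ring
    _ ≤ _ := mul_le_mul_of_nonneg_left
        (Finset.sum_le_sum fun i _ => Finset.sum_le_sum fun j _ => hw i j) (Nat.cast_nonneg _)

variable {F : Type*} [NormedAddCommGroup F] [InnerProductSpace ℝ F]

/-- A positive semidefinite `2 × 2` form stays nonnegative when its scalar arguments become vectors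
and products become inner products. Here `BᵀP` produces the combination `k₁ u + k₂ v`. -/
lemma riccati_inner_le {k₀ k₁ k₂ β₁ : ℝ} {P C : Matrix (Fin 2) (Fin 2) ℝ}
    {B : Matrix (Fin 2) (Fin 1) ℝ}
    (hC : C = !![0, 1; 0, 0]) (hB : B = !![0; 1]) (hP : P = !![k₀, k₁; k₁, k₂])
    (h : (-((1 / 2 : ℝ) • (P * C + Cᵀ * P) - β₁ • (P * B * Bᵀ * P)
      + (2 : ℝ) • (1 : Matrix (Fin 2) (Fin 2) ℝ))).PosSemidef) (u v : F) :
    k₀ * inner ℝ u v + k₁ * ‖v‖ ^ 2 - β₁ * ‖k₁ • u + k₂ • v‖ ^ 2 +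
      2 * (‖u‖ ^ 2 + ‖v‖ ^ 2) ≤ 0 := by
  have hM : -((1 / 2 : ℝ) • (P * C + Cᵀ * P) - β₁ • (P * B * Bᵀ * P)
      + (2 : ℝ) • (1 : Matrix (Fin 2) (Fin 2) ℝ)) =
      !![β₁ * k₁ ^ 2 - 2, β₁ * (k₁ * k₂) - k₀ / 2;
         β₁ * (k₁ * k₂) - k₀ / 2, β₁ * k₂ ^ 2 - k₁ - 2] := by
    subst hC hB hP
    ext i j
    fin_cases i <;> fin_cases j <;>
      simp [Matrix.mul_apply, Fin.sum_univ_two, Matrix.vecMul, dotProduct] <;> ring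
  rw [hM] at h
  obtain ⟨h1, h2, h3⟩ := two_by_two_posSemidef h
  have h4 := quadratic_inner_nonneg h1 h2 h3 u v
  have h5 : ‖k₁ • u + k₂ • v‖ ^ 2 =
      k₁ ^ 2 * ‖u‖ ^ 2 + 2 * (k₁ * k₂) * inner ℝ u v + k₂ ^ 2 * ‖v‖ ^ 2 := by
    rw [norm_add_sq_real, norm_smul, norm_smul, mul_pow, mul_pow, real_inner_smul_left,
      real_inner_smul_right, Real.norm_eq_abs, Real.norm_eq_abs, sq_abs, sq_abs]
    ring
  rw [h5]
  linarith

/-- The form `⟨k₁ u + k₂ v, v⟩` has the eigenvalues `(k₂ ± √(k₁² + k₂²))/2`; the constant is the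
larger one, which is also the larger in absolute value. -/
lemma damping_inner_le {k₁ k₂ k₃ : ℝ} (hk₂ : 0 < k₂) (hk₃ : 0 < k₃) (u v : F) :
    -(k₃ * inner ℝ (k₁ • u + k₂ • v) v) ≤
      k₃ * ((k₂ + √(k₁ ^ 2 + k₂ ^ 2)) / 2) * (‖u‖ ^ 2 + ‖v‖ ^ 2) := by
  set s := √(k₁ ^ 2 + k₂ ^ 2) with hs
  have hs2 : s ^ 2 = k₁ ^ 2 + k₂ ^ 2 := Real.sq_sqrt (by positivity)
  have hs0 : 0 ≤ s := Real.sqrt_nonneg _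
  have h := quadratic_inner_nonneg (a := (k₂ + s) / 2) (b := k₁ / 2) (c := (k₂ + s) / 2 + k₂)
    (by positivity) (by positivity) (by nlinarith [mul_nonneg hk₂.le hs0]) u v
  rw [inner_add_left, real_inner_smul_left, real_inner_smul_left, real_inner_self_eq_norm_sq]
  nlinarith

/-- The determinant over the trace is a lower bound of the smallest eigenvalue: for this `m`, `(a -
m)(c - m) - b² = m²`. -/
lemma exists_quadratic_lower_bound {a b c : ℝ} (ha : 0 < a) (hc : 0 < c) (h : b ^ 2 < a * c) :
    ∃ m, 0 < m ∧ ∀ u v : F, m * (‖u‖ ^ 2 + ‖v‖ ^ 2) ≤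
      a * ‖u‖ ^ 2 + 2 * b * inner ℝ u v + c * ‖v‖ ^ 2 := by
  have hac : 0 < a + c := by linarith
  set m := (a * c - b ^ 2) / (a + c) with hm
  have hm1 : m * (a + c) = a * c - b ^ 2 := by rw [hm]; field_simp
  refine ⟨m, div_pos (by linarith) hac, fun u v => ?_⟩
  have h1 : m ≤ a := by
    rw [hm, div_le_iff₀ hac]
    nlinarith [sq_nonneg b, mul_pos ha ha]
  have h2 : m ≤ c := by
    rw [hm, div_le_iff₀ hac]
    nlinarith [sq_nonneg b, mul_pos hc hc]
  have := quadratic_inner_nonneg (a := a - m) (b := b) (c := c - m) (by linarith) (by linarith)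
    (by nlinarith [sq_nonneg m]) u v
  linarith

lemma quadratic_upper_bound {a b c l : ℝ} (ha : a ≤ l) (hc : c ≤ l)
    (h : b ^ 2 ≤ (l - a) * (l - c)) (u v : F) :
    a * ‖u‖ ^ 2 + 2 * b * inner ℝ u v + c * ‖v‖ ^ 2 ≤ l * (‖u‖ ^ 2 + ‖v‖ ^ 2) := by
  have := quadratic_inner_nonneg (a := l - a) (b := -b) (c := l - c) (by linarith) (by linarith)
    (by linarith [neg_sq b]) u v
  linarith

end Parameters

/-! ### Decay of the disagreements and of the total momentum -/

section Disagreement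

variable {V : Type*} [Fintype V] {p : ℕ} {N : Network V p} {g : Gains}
  {τ : V → EuclideanSpace ℝ (Fin p)} {x q e : ℝ → V → EuclideanSpace ℝ (Fin p)} {b k₀ : ℝ}

/-- The quadratic Lyapunov function of the disagreements of positions and velocities. -/
def disagreement (g : Gains) (k₀ : ℝ) (z q : V → EuclideanSpace ℝ (Fin p)) : ℝ :=
  1 / 2 * ∑ i, ∑ j, (k₀ * ‖z i - z j‖ ^ 2 + 2 * g.k₁ * inner ℝ (z i - z j) (q i - q j) +
    g.k₂ * ‖q i - q j‖ ^ 2)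

/-- Both feedbacks together are one weighted Laplacian applied to `k₁ (x - τ) + k₂ q`, the vector
that also appears when the form of `P` is differentiated in `q`. -/
lemma feedback_eq (hτ : ∀ i j, N.graph.Adj i j → τ i - τ j = N.d i j)
    (y v : V → EuclideanSpace ℝ (Fin p)) (i : V) :
    g.k₁ • N.posFeedback y i + g.k₂ • N.velFeedback y v i =
      ∑ j, N.weight y i j • ((g.k₁ • (y i - τ i) + g.k₂ • v i) -
        (g.k₁ • (y j - τ j) + g.k₂ • v j)) := by
  rw [posFeedback_eq hτ, Network.velFeedback, Finset.smul_sum, Finset.smul_sum,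
    ← Finset.sum_add_distrib]
  refine Finset.sum_congr rfl fun j _ => ?_
  module

/-- The feedback is paired with the differences of the same combination `w = k₁ (x - τ) + k₂ q`, so
summing over pairs turns it into `-n` times the weighted Dirichlet form of `w`. -/
lemma IsClosedLoop.hasDerivWithinAt_disagreement (h : IsClosedLoop N g b x q e)
    (hτ : ∀ i j, N.graph.Adj i j → τ i - τ j = N.d i j) {t : ℝ} (ht : t ∈ Set.Ico 0 b) :
    HasDerivWithinAt (fun r => disagreement g k₀ (fun i => x r i - τ i) (q r))
      (∑ i, ∑ j, (k₀ * inner ℝ ((x t i - τ i) - (x t j - τ j)) (q t i - q t j) +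
        g.k₁ * ‖q t i - q t j‖ ^ 2 -
        g.k₃ * inner ℝ (g.k₁ • ((x t i - τ i) - (x t j - τ j)) + g.k₂ • (q t i - q t j))
          (q t i - q t j) +
        inner ℝ (g.k₁ • ((x t i - τ i) - (x t j - τ j)) + g.k₂ • (q t i - q t j))
          (e t i - e t j)) -
        Fintype.card V * ∑ i, ∑ j, N.weight (x t) i j *
          ‖g.k₁ • ((x t i - τ i) - (x t j - τ j)) + g.k₂ • (q t i - q t j)‖ ^ 2)
      (Set.Ici t) t := by
  have hz : ∀ i j, HasDerivWithinAt (fun r => (x r i - τ i) - (x r j - τ j)) (q t i - q t j)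
      (Set.Ici t) t := fun i j =>
    ((h.deriv_x i t ht).sub_const _).sub ((h.deriv_x j t ht).sub_const _)
  have hq : ∀ i j, HasDerivWithinAt (fun r => q r i - q r j) _ (Set.Ici t) t := fun i j =>
    (h.deriv_q i t ht).sub (h.deriv_q j t ht)
  have h1 := (HasDerivWithinAt.fun_sum fun i (_ : i ∈ Finset.univ) =>
    HasDerivWithinAt.fun_sum fun j (_ : j ∈ Finset.univ) =>
      (((hz i j).norm_sq.const_mul k₀).add
        (((hz i j).inner ℝ (hq i j)).const_mul (2 * g.k₁))).add
        ((hq i j).norm_sq.const_mul g.k₂)).const_mul (1 / 2)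
  refine h1.congr_deriv ?_
  set w : V → EuclideanSpace ℝ (Fin p) := fun i => g.k₁ • (x t i - τ i) + g.k₂ • q t i with hw
  have hww : ∀ i j, w i - w j =
      g.k₁ • ((x t i - τ i) - (x t j - τ j)) + g.k₂ • (q t i - q t j) := fun i j => by
    simp only [hw]; module
  have h2 := sum_sum_inner_sub_weighted (N.weight (x t)) (weight_comm hτ _) w w
  simp only [real_inner_self_eq_norm_sq] at h2
  simp only [← hww]
  rw [← h2, ← Finset.sum_sub_distrib, Finset.mul_sum]
  refine Finset.sum_congr rfl fun i _ => ?_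
  rw [← Finset.sum_sub_distrib, Finset.mul_sum]
  refine Finset.sum_congr rfl fun j _ => ?_
  have h3 : ∀ i, -(g.k₁ • N.posFeedback (x t) i) - g.k₂ • N.velFeedback (x t) (q t) i -
      g.k₃ • q t i + e t i = -(∑ k, N.weight (x t) i k • (w i - w k)) - g.k₃ • q t i + e t i :=
    fun i => by
      have := feedback_eq (g := g) hτ (x t) (q t) i
      simp only [hw]
      rw [← this]
      abel
  rw [h3, h3]
  set G := ∑ k, N.weight (x t) i k • (w i - w k)
  set G' := ∑ k, N.weight (x t) j k • (w j - w k)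
  have h4 : -G - g.k₃ • q t i + e t i - (-G' - g.k₃ • q t j + e t j) =
      -(G - G') - g.k₃ • (q t i - q t j) + (e t i - e t j) := by module
  rw [h4, hww]
  set zz := (x t i - τ i) - (x t j - τ j)
  set qq := q t i - q t j
  simp only [inner_add_right, inner_sub_right, inner_neg_right, real_inner_smul_right,
    inner_add_left, real_inner_smul_left, real_inner_self_eq_norm_sq, real_inner_comm qq zz]
  ring

/-- Exponential decay of all disagreements, at any rate below that of the Lyapunov function and
not exceeding that of the threshold. -/
lemma exists_disagreement_decay [Nonempty V]
    (hτ : ∀ i j, N.graph.Adj i j → τ i - τ j = N.d i j) {β₁ k₄ l m γ : ℝ}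
    (hw : ∀ y : V → EuclideanSpace ℝ (Fin p), N.InitialOK y →
      ∀ u : V → EuclideanSpace ℝ (Fin p), β₁ * ∑ i, ∑ j, ‖u i - u j‖ ^ 2 ≤
        Fintype.card V * ∑ i, ∑ j, N.weight y i j * ‖u i - u j‖ ^ 2)
    (hric : ∀ u v : EuclideanSpace ℝ (Fin p), k₀ * inner ℝ u v + g.k₁ * ‖v‖ ^ 2 -
      β₁ * ‖g.k₁ • u + g.k₂ • v‖ ^ 2 + 2 * (‖u‖ ^ 2 + ‖v‖ ^ 2) ≤ 0)
    (hdamp : ∀ u v : EuclideanSpace ℝ (Fin p), -(g.k₃ * inner ℝ (g.k₁ • u + g.k₂ • v) v) ≤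
      k₄ * (‖u‖ ^ 2 + ‖v‖ ^ 2))
    (hl : 0 < l) (hup : ∀ u v : EuclideanSpace ℝ (Fin p),
      k₀ * ‖u‖ ^ 2 + 2 * g.k₁ * inner ℝ u v + g.k₂ * ‖v‖ ^ 2 ≤ l * (‖u‖ ^ 2 + ‖v‖ ^ 2))
    (hm : 0 < m) (hlow : ∀ u v : EuclideanSpace ℝ (Fin p), m * (‖u‖ ^ 2 + ‖v‖ ^ 2) ≤
      k₀ * ‖u‖ ^ 2 + 2 * g.k₁ * inner ℝ u v + g.k₂ * ‖v‖ ^ 2)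
    (hk₁ : 0 < g.k₁) (hk₂ : 0 < g.k₂) (hα : 0 < g.α) (hk₄ : k₄ < 2)
    (hγ : γ < (2 - k₄) / l) (hγβ : γ ≤ g.β) (x₀ q₀ : V → EuclideanSpace ℝ (Fin p)) :
    ∃ c, 0 < c ∧ ∀ (b : ℝ) (x q e : ℝ → V → EuclideanSpace ℝ (Fin p)),
      IsClosedLoop N g b x q e → (∀ t ∈ Set.Icc 0 b, N.InitialOK (x t)) → x 0 = x₀ → q 0 = q₀ →
      ∀ t ∈ Set.Icc 0 b, ∀ i j,
        ‖(x t i - τ i) - (x t j - τ j)‖ ≤ c * Real.exp (-γ * t) ∧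
          ‖q t i - q t j‖ ≤ c * Real.exp (-γ * t) := by
  set n : ℝ := (Fintype.card V : ℝ) with hn
  -- There are `n²` ordered pairs; in each, `‖k₁ z + k₂ q‖ ≤ (k₁ + k₂) √(2/m) √D` meets an error
  -- difference of at most `2α e^{-βt}`.
  set K : ℝ := n * n * ((g.k₁ + g.k₂) * √(2 / m) * (2 * g.α)) with hK
  have hK0 : 0 ≤ K := by positivity
  obtain ⟨A, hA, hdecay⟩ := exists_decay_bound K
    (disagreement g k₀ (fun i => x₀ i - τ i) q₀) hK0 hγ
  refine ⟨√(2 / m * A), by positivity, fun b x q e h hok hx hq => ?_⟩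
  set D : ℝ → ℝ := fun r => disagreement g k₀ (fun i => x r i - τ i) (q r) with hD
  have hpair : ∀ t i j, m / 2 * (‖(x t i - τ i) - (x t j - τ j)‖ ^ 2 + ‖q t i - q t j‖ ^ 2) ≤
      D t := by
    intro t i j
    set f : V → V → ℝ := fun i j => k₀ * ‖(x t i - τ i) - (x t j - τ j)‖ ^ 2 +
      2 * g.k₁ * inner ℝ ((x t i - τ i) - (x t j - τ j)) (q t i - q t j) +
      g.k₂ * ‖q t i - q t j‖ ^ 2 with hf
    have hf0 : ∀ i j, 0 ≤ f i j := fun i j => le_trans (by positivity) (hlow _ _)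
    have h1 : f i j ≤ ∑ i, ∑ j, f i j :=
      (Finset.single_le_sum (fun j _ => hf0 i j) (Finset.mem_univ j)).trans
        (Finset.single_le_sum (f := fun i => ∑ j, f i j)
          (fun i _ => Finset.sum_nonneg fun j _ => hf0 i j) (Finset.mem_univ i))
    have h2 := hlow ((x t i - τ i) - (x t j - τ j)) (q t i - q t j)
    have h3 : D t = 1 / 2 * ∑ i, ∑ j, f i j := rfl
    rw [h3]
    have h4 : f i j = k₀ * ‖(x t i - τ i) - (x t j - τ j)‖ ^ 2 +
      2 * g.k₁ * inner ℝ ((x t i - τ i) - (x t j - τ j)) (q t i - q t j) +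
      g.k₂ * ‖q t i - q t j‖ ^ 2 := rfl
    linarith
  have hsq : ∀ t i j, ‖(x t i - τ i) - (x t j - τ j)‖ ≤ √(2 / m) * √(D t) ∧
      ‖q t i - q t j‖ ≤ √(2 / m) * √(D t) := by
    intro t i j
    have h1 : ‖(x t i - τ i) - (x t j - τ j)‖ ^ 2 + ‖q t i - q t j‖ ^ 2 ≤ 2 / m * D t := by
      have := mul_le_mul_of_nonneg_left (hpair t i j) (show 0 ≤ 2 / m by positivity)
      calc _ = 2 / m * (m / 2 *
            (‖(x t i - τ i) - (x t j - τ j)‖ ^ 2 + ‖q t i - q t j‖ ^ 2)) := by field_simp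
        _ ≤ _ := this
    rw [← Real.sqrt_mul (by positivity)]
    exact ⟨Real.le_sqrt_of_sq_le (by linarith [sq_nonneg ‖q t i - q t j‖]),
      Real.le_sqrt_of_sq_le (by linarith [sq_nonneg ‖(x t i - τ i) - (x t j - τ j)‖])⟩
  have hcont : ContinuousOn D (Set.Icc 0 b) := by
    have hz : ∀ i j, ContinuousOn (fun t => (x t i - τ i) - (x t j - τ j)) (Set.Icc 0 b) :=
      fun i j => ((h.cont_x i).sub continuousOn_const).sub ((h.cont_x j).sub continuousOn_const)
    have hqc : ∀ i j, ContinuousOn (fun t => q t i - q t j) (Set.Icc 0 b) :=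
      fun i j => (h.cont_q i).sub (h.cont_q j)
    exact continuousOn_const.mul <| continuousOn_finsetSum _ fun i _ =>
      continuousOn_finsetSum _ fun j _ =>
        ((continuousOn_const.mul ((hz i j).norm.pow 2)).add
          (continuousOn_const.mul ((hz i j).inner (hqc i j)))).add
          (continuousOn_const.mul ((hqc i j).norm.pow 2))
  have hD0 : D 0 ≤ disagreement g k₀ (fun i => x₀ i - τ i) q₀ := by simp only [hD, hx, hq, le_refl]
  have hfin := hdecay g.β b D _ hγβ hcont
    (fun t ht => h.hasDerivWithinAt_disagreement hτ ht) hD0 ?_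
  · intro t ht i j
    have h1 := hfin t ht
    have h2 : √(2 / m) * √(D t) ≤ √(2 / m * A) * Real.exp (-γ * t) := by
      calc √(2 / m) * √(D t) ≤ √(2 / m) * √(A * Real.exp (-(2 * γ) * t)) := by gcongr
        _ = √(2 / m * A) * Real.exp (-γ * t) := by
          rw [Real.sqrt_mul hA.le, ← Real.exp_half, Real.sqrt_mul (by positivity), ← mul_assoc]
          congr 2
          ring
    exact ⟨(hsq t i j).1.trans h2, (hsq t i j).2.trans h2⟩
  · intro t ht
    set zz : V → V → EuclideanSpace ℝ (Fin p) := fun i j => (x t i - τ i) - (x t j - τ j) with hzz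
    set qq : V → V → EuclideanSpace ℝ (Fin p) := fun i j => q t i - q t j with hqq
    set Y : V → V → ℝ := fun i j => ‖zz i j‖ ^ 2 + ‖qq i j‖ ^ 2 with hY
    set ε := Real.exp (-g.β * t) with hε
    have hε0 : 0 < ε := Real.exp_pos _
    have hwp := hw (x t) (hok t (Set.Ico_subset_Icc_self ht))
      (fun i => g.k₁ • (x t i - τ i) + g.k₂ • q t i)
    have hww : ∀ i j, g.k₁ • (x t i - τ i) + g.k₂ • q t i -
        (g.k₁ • (x t j - τ j) + g.k₂ • q t j) = g.k₁ • zz i j + g.k₂ • qq i j := fun i j => by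
      simp only [hzz, hqq]; module
    simp only [hww] at hwp
    have herr : ∀ i j, inner ℝ (g.k₁ • zz i j + g.k₂ • qq i j) (e t i - e t j) ≤
        (g.k₁ + g.k₂) * √(2 / m) * (2 * g.α) * √(D t) * ε := fun i j => by
      have h1 : ‖e t i - e t j‖ ≤ 2 * g.α * ε := by
        have h2 := h.err i t ht
        have h3 := h.err j t ht
        have := norm_sub_le (e t i) (e t j)
        linarith
      have h4 : ‖g.k₁ • zz i j + g.k₂ • qq i j‖ ≤ (g.k₁ + g.k₂) * (√(2 / m) * √(D t)) := by
        refine (norm_add_le _ _).trans ?_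
        rw [norm_smul, norm_smul, Real.norm_of_nonneg hk₁.le, Real.norm_of_nonneg hk₂.le, add_mul]
        exact add_le_add (mul_le_mul_of_nonneg_left (hsq t i j).1 hk₁.le)
          (mul_le_mul_of_nonneg_left (hsq t i j).2 hk₂.le)
      calc _ ≤ ‖g.k₁ • zz i j + g.k₂ • qq i j‖ * ‖e t i - e t j‖ := real_inner_le_norm _ _
        _ ≤ ((g.k₁ + g.k₂) * (√(2 / m) * √(D t))) * (2 * g.α * ε) := by gcongr
        _ = _ := by ring
    have hDup : D t ≤ l / 2 * ∑ i, ∑ j, Y i j := by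
      have h1 : D t = 1 / 2 * ∑ i, ∑ j, (k₀ * ‖zz i j‖ ^ 2 + 2 * g.k₁ * inner ℝ (zz i j) (qq i j) +
        g.k₂ * ‖qq i j‖ ^ 2) := rfl
      have h2 : ∑ i, ∑ j, (k₀ * ‖zz i j‖ ^ 2 + 2 * g.k₁ * inner ℝ (zz i j) (qq i j) +
        g.k₂ * ‖qq i j‖ ^ 2) ≤ l * ∑ i, ∑ j, Y i j := by
        rw [Finset.mul_sum]
        refine Finset.sum_le_sum fun i _ => ?_
        rw [Finset.mul_sum]
        exact Finset.sum_le_sum fun j _ => hup _ _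
      rw [h1]
      linarith
    -- Riccati and damping are applied to each pair; the remaining `β₁ ‖k₁ z + k₂ q‖²` is cancelled
    -- only after summation, by `hwp`.
    have hsum : ∑ i, ∑ j, (k₀ * inner ℝ (zz i j) (qq i j) + g.k₁ * ‖qq i j‖ ^ 2 -
        g.k₃ * inner ℝ (g.k₁ • zz i j + g.k₂ • qq i j) (qq i j) +
        inner ℝ (g.k₁ • zz i j + g.k₂ • qq i j) (e t i - e t j)) ≤
        ∑ i, ∑ j, (β₁ * ‖g.k₁ • zz i j + g.k₂ • qq i j‖ ^ 2 - (2 - k₄) * Y i j +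
          (g.k₁ + g.k₂) * √(2 / m) * (2 * g.α) * √(D t) * ε) := by
      refine Finset.sum_le_sum fun i _ => Finset.sum_le_sum fun j _ => ?_
      have h1 := hric (zz i j) (qq i j)
      have h2 := hdamp (zz i j) (qq i j)
      have h3 := herr i j
      simp only [hY]
      linarith
    have hsum2 : ∑ i, ∑ j, (β₁ * ‖g.k₁ • zz i j + g.k₂ • qq i j‖ ^ 2 - (2 - k₄) * Y i j +
          (g.k₁ + g.k₂) * √(2 / m) * (2 * g.α) * √(D t) * ε) =
        β₁ * (∑ i, ∑ j, ‖g.k₁ • zz i j + g.k₂ • qq i j‖ ^ 2) - (2 - k₄) * (∑ i, ∑ j, Y i j) +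
          K * √(D t) * ε := by
      simp only [Finset.sum_add_distrib, Finset.sum_sub_distrib, ← Finset.mul_sum,
        Finset.sum_const, Finset.card_univ, nsmul_eq_mul, hK, hn]
      ring
    have hfinal : -(2 - k₄) * (∑ i, ∑ j, Y i j) ≤ -(2 * ((2 - k₄) / l)) * D t := by
      have h1 : 0 ≤ 2 * ((2 - k₄) / l) := by
        have : 0 < 2 - k₄ := by linarith
        positivity
      have h2 := mul_le_mul_of_nonneg_left hDup h1
      have h3 : 2 * ((2 - k₄) / l) * (l / 2 * ∑ i, ∑ j, Y i j) =
        (2 - k₄) * ∑ i, ∑ j, Y i j := by field_simp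
      linarith
    linarith

/-- Decay of the total momentum. -/
lemma exists_sum_velocity_decay (hτ : ∀ i j, N.graph.Adj i j → τ i - τ j = N.d i j)
    (hk₃ : 0 < g.k₃) (hβ : 0 < g.β) (hα : 0 < g.α) (q₀ : V → EuclideanSpace ℝ (Fin p)) :
    ∃ c γ, 0 < γ ∧ ∀ (b : ℝ) (x q e : ℝ → V → EuclideanSpace ℝ (Fin p)),
      IsClosedLoop N g b x q e → q 0 = q₀ →
      ∀ t ∈ Set.Icc 0 b, ‖∑ i, q t i‖ ≤ c * Real.exp (-γ * t) := by
  set n : ℝ := (Fintype.card V : ℝ) with hn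
  -- The comparison lemma needs a rate at most `β` and strictly below `k₃`.
  set γ := min g.β (g.k₃ / 2) with hγ
  have hγ0 : 0 < γ := lt_min hβ (by positivity)
  have hγk : γ < g.k₃ := (min_le_right _ _).trans_lt (by linarith)
  obtain ⟨A, hA, hdecay⟩ := exists_decay_bound (2 * n * g.α) (‖∑ i, q₀ i‖ ^ 2)
    (by positivity) hγk
  refine ⟨√A, γ, hγ0, fun b x q e h hq t ht => ?_⟩
  have hcont : ContinuousOn (fun t => ‖∑ i, q t i‖ ^ 2) (Set.Icc 0 b) :=
    (continuousOn_finsetSum _ fun i _ => h.cont_q i).norm.pow 2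
  have hder : ∀ t ∈ Set.Ico 0 b, HasDerivWithinAt (fun t => ∑ i, q t i)
      (-(g.k₃ • ∑ i, q t i) + ∑ i, e t i) (Set.Ici t) t := fun t ht => by
    refine (HasDerivWithinAt.fun_sum fun i (_ : i ∈ Finset.univ) =>
      h.deriv_q i t ht).congr_deriv ?_
    -- By symmetry of the weights the internal forces cancel.
    have h0 : ∑ i, (g.k₁ • N.posFeedback (x t) i + g.k₂ • N.velFeedback (x t) (q t) i) = 0 := by
      simp only [feedback_eq hτ]
      exact sum_sum_smul_sub_eq_zero (N.weight (x t)) (weight_comm hτ _)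
        (fun i => g.k₁ • (x t i - τ i) + g.k₂ • q t i)
    rw [Finset.smul_sum, ← Finset.sum_neg_distrib, ← Finset.sum_add_distrib, ← sub_eq_zero,
      ← Finset.sum_sub_distrib, ← neg_eq_zero, ← Finset.sum_neg_distrib, ← h0]
    refine Finset.sum_congr rfl fun i _ => ?_
    abel
  have := hdecay g.β b (fun t => ‖∑ i, q t i‖ ^ 2) _ (min_le_left _ _) hcont
    (fun t ht => (hder t ht).norm_sq) (by simp only [hq, le_refl]) ?_ t ht
  · have h1 := Real.sqrt_le_sqrt this
    rw [Real.sqrt_sq (norm_nonneg _), Real.sqrt_mul hA.le, ← Real.exp_half] at h1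
    convert h1 using 3
    ring
  · intro t ht
    rw [Real.sqrt_sq (norm_nonneg _), inner_add_right, inner_neg_right, real_inner_smul_right,
      real_inner_self_eq_norm_sq]
    have h1 : ‖∑ i, e t i‖ ≤ n * (g.α * Real.exp (-g.β * t)) := by
      refine (norm_sum_le _ _).trans ((Finset.sum_le_sum fun i _ => h.err i t ht).trans ?_)
      rw [Finset.sum_const, Finset.card_univ, nsmul_eq_mul]
    have h2 := real_inner_le_norm (∑ i, q t i) (∑ i, e t i)
    have h3 : ‖∑ i, q t i‖ * ‖∑ i, e t i‖ ≤ ‖∑ i, q t i‖ * (n * (g.α * Real.exp (-g.β * t))) := by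
      gcongr
    linarith

end Disagreement

/-! ### Successive triggering times -/

section TriggerSets

lemma exists_isNextTrigger {S : Set ℝ} {s r : ℝ} (hs : s ∈ S) (hr : r ∈ S) (hsr : s < r)
    (hfin : (S ∩ Set.Iic r).Finite) : ∃ s', IsNextTrigger S s s' ∧ s' ≤ r := by
  obtain ⟨s', ⟨⟨hs'S, hs'r⟩, hss'⟩, hmin⟩ := Set.exists_min_image ((S ∩ Set.Iic r) ∩ Set.Ioi s) id
    (hfin.inter_of_left _) ⟨r, ⟨hr, Set.self_mem_Iic⟩, hsr⟩
  refine ⟨s', ⟨hs, hs'S, hss', fun u hu hsu => ?_⟩, hs'r⟩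
  rcases le_or_gt u r with h | h
  · exact hmin u ⟨⟨hu, h⟩, hsu⟩
  · exact le_trans hs'r h.le

/-- Accumulation is possible only at `T`, and the window `(T - ε, T)` holds at most one triggering
time. -/
lemma finite_of_gap {S : Set ℝ} {T ε : ℝ} (hε : 0 < ε) (hT : ∀ s ∈ S, s < T)
    (hfin : ∀ t < T, (S ∩ Set.Iic t).Finite)
    (hgap : ∀ s s', IsNextTrigger S s s' → ε ≤ s' - s) : S.Finite := by
  have h1 : (S ∩ Set.Ioi (T - ε)).Subsingleton := by
    have key : ∀ s ∈ S, T - ε < s → ∀ r ∈ S, ¬ s < r := fun s hs hs' r hr hsr => by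
      obtain ⟨s', hnext, hle⟩ := exists_isNextTrigger hs hr hsr (hfin r (hT r hr))
      linarith [hgap s s' hnext, hT r hr]
    intro s hs r hr
    exact le_antisymm (not_lt.1 (key r hr.1 hr.2 s hs.1)) (not_lt.1 (key s hs.1 hs.2 r hr.1))
  refine ((hfin (T - ε) (by linarith)).union h1.finite).subset fun s hs => ?_
  rcases le_or_gt s (T - ε) with h | h
  · exact Or.inl ⟨hs, h⟩
  · exact Or.inr ⟨hs, h⟩

end TriggerSets

/-! ### Growth of the measurement error between updates -/

section Lipschitz

variable {V : Type*} [Fintype V] {p : ℕ} {N : Network V p} {g : Gains}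

/-- Each edge has its own constants, which depend on the distance of `R` from the margin; their sum
over all pairs serves as a common bound. -/
lemma exists_weight_bounds {R : V → V → ℝ}
    (hR : ∀ i j, N.graph.Adj i j → R i j < N.Δ - ‖N.d i j‖) :
    ∃ W L : ℝ, 0 ≤ W ∧ 0 ≤ L ∧ ∀ y y' : V → EuclideanSpace ℝ (Fin p),
      (∀ i j, N.graph.Adj i j → ‖y i - y j - N.d i j‖ ≤ R i j) →
      (∀ i j, N.graph.Adj i j → ‖y' i - y' j - N.d i j‖ ≤ R i j) → ∀ i j,
        |N.weight y i j| ≤ W ∧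
          |N.weight y i j - N.weight y' i j| ≤ L * ‖(y i - y j) - (y' i - y' j)‖ := by
  set a : V → V → ℝ := fun i j => N.Δ - ‖N.d i j‖ with ha
  set w : V → V → ℝ := fun i j =>
    |1 / (a i j - R i j) + a i j * (1 / (a i j - R i j)) ^ 2| with hw
  set l : V → V → ℝ := fun i j =>
    |(1 / (a i j - R i j)) ^ 2 * (1 + 2 * a i j * (1 / (a i j - R i j)))| with hl
  have hle : ∀ f : V → V → ℝ, (∀ i j, 0 ≤ f i j) → ∀ i j, f i j ≤ ∑ i, ∑ j, f i j :=
    fun f hf i j => (Finset.single_le_sum (fun j _ => hf i j) (Finset.mem_univ j)).trans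
      (Finset.single_le_sum (f := fun i => ∑ j, f i j)
        (fun i _ => Finset.sum_nonneg fun j _ => hf i j) (Finset.mem_univ i))
  have hw0 : ∀ i j, 0 ≤ w i j := fun i j => abs_nonneg _
  have hl0 : ∀ i j, 0 ≤ l i j := fun i j => abs_nonneg _
  have hW : 0 ≤ ∑ i, ∑ j, w i j := Finset.sum_nonneg fun i _ => Finset.sum_nonneg fun j _ => hw0 i j
  have hL : 0 ≤ ∑ i, ∑ j, l i j := Finset.sum_nonneg fun i _ => Finset.sum_nonneg fun j _ => hl0 i j
  refine ⟨∑ i, ∑ j, w i j, ∑ i, ∑ j, l i j, hW, hL, fun y y' hy hy' i j => ?_⟩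
  by_cases hij : N.graph.Adj i j
  · have h1 := hy i j hij
    have h2 := hy' i j hij
    have h3 := hR i j hij
    rw [weight_of_adj hij, weight_of_adj hij]
    constructor
    · rw [abs_of_nonneg (weightFun_nonneg (norm_nonneg _) (h1.trans_lt h3))]
      exact (weightFun_le (norm_nonneg _) h1 h3).trans ((le_abs_self _).trans (hle w hw0 i j))
    · refine (abs_weightFun_sub_le (norm_nonneg _) h1 h2 h3).trans ?_
      refine mul_le_mul ((le_abs_self _).trans (hle l hl0 i j)) ?_ (abs_nonneg _) hL
      refine (abs_norm_sub_norm_le _ _).trans_eq ?_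
      rw [sub_sub_sub_cancel_right]
  · rw [weight_of_not_adj hij, weight_of_not_adj hij, abs_zero, sub_zero, abs_zero]
    exact ⟨hW, by positivity⟩

lemma norm_smul_sub_smul_le {F : Type*} [NormedAddCommGroup F] [NormedSpace ℝ F] {a a' A D B M : ℝ}
    {u u' : F} (ha : |a - a'| ≤ A) (hu : ‖u‖ ≤ M) (ha' : |a'| ≤ B) (hD : ‖u - u'‖ ≤ D) :
    ‖a • u - a' • u'‖ ≤ A * M + B * D := by
  have : a • u - a' • u' = (a - a') • u + a' • (u - u') := by module
  rw [this]
  refine (norm_add_le _ _).trans ?_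
  rw [norm_smul, norm_smul, Real.norm_eq_abs, Real.norm_eq_abs]
  exact add_le_add (mul_le_mul ha hu (norm_nonneg _) ((abs_nonneg _).trans ha))
    (mul_le_mul ha' hD (norm_nonneg _) ((abs_nonneg _).trans ha'))

/-- Along decaying trajectories, the measurement error grows at most linearly, with a decaying
slope. -/
lemma exists_triggerError_le {R : V → V → ℝ}
    (hR : ∀ i j, N.graph.Adj i j → R i j < N.Δ - ‖N.d i j‖) (hk₁ : 0 < g.k₁) (hk₂ : 0 < g.k₂)
    (hk₃ : 0 < g.k₃) (hα : 0 < g.α) {c γ : ℝ} (hc : 0 < c) (hγ : 0 ≤ γ) (hγβ : γ ≤ g.β) :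
    ∃ K, 0 < K ∧ ∀ (b : ℝ) (x q e : ℝ → V → EuclideanSpace ℝ (Fin p)), IsClosedLoop N g b x q e →
      (∀ t ∈ Set.Icc 0 b, ∀ i j, N.graph.Adj i j → ‖x t i - x t j - N.d i j‖ ≤ R i j) →
      (∀ t ∈ Set.Icc 0 b, ∀ i j, N.graph.Adj i j →
        ‖x t i - x t j - N.d i j‖ ≤ c * Real.exp (-γ * t)) →
      (∀ t ∈ Set.Icc 0 b, ∀ i j, ‖q t i - q t j‖ ≤ c * Real.exp (-γ * t)) →
      ∀ s t, 0 ≤ s → s ≤ t → t ≤ b → ∀ i,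
        ‖triggerError N g x q i s t‖ ≤ K * Real.exp (-γ * s) * (t - s) := by
  obtain ⟨W, L, hW, hL, hwt⟩ := exists_weight_bounds hR
  set n : ℝ := (Fintype.card V : ℝ) with hn
  -- Bounds the slope of `q_i - q_j`: two feedbacks and an error for each of the two agents, and the
  -- damping of the difference.
  set K₁ : ℝ := 2 * g.k₁ * (n * (W * c)) + 2 * g.k₂ * (n * (W * c)) + g.k₃ * c + 2 * g.α with hK₁
  have hK₁0 : 0 ≤ K₁ := by positivity
  -- In each summand, change of the weight times size of the vector plus size of the weight times
  -- change of the vector. The `+ 1` keeps the constant positive.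
  refine ⟨g.k₁ * (n * (L * c * c + W * c)) + g.k₂ * (n * (L * c * c + W * K₁)) + 1, by positivity,
    fun b x q e h hxR hxc hqc s t hs hst htb i => ?_⟩
  have hpf : ∀ r ∈ Set.Icc 0 b, ∀ i, ‖N.posFeedback (x r) i‖ ≤
      n * (W * (c * Real.exp (-γ * r))) := fun r hr i => by
    refine (norm_sum_le _ _).trans ((Finset.sum_le_sum (g := fun _ =>
      W * (c * Real.exp (-γ * r))) fun j _ => ?_).trans_eq (by simp [hn]))
    by_cases hij : N.graph.Adj i j
    · rw [norm_smul]
      exact mul_le_mul (hwt _ _ (hxR r hr) (hxR r hr) i j).1 (hxc r hr i j hij) (norm_nonneg _) hW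
    · rw [weight_of_not_adj hij, zero_smul, norm_zero]
      positivity
  have hvf : ∀ r ∈ Set.Icc 0 b, ∀ i, ‖N.velFeedback (x r) (q r) i‖ ≤
      n * (W * (c * Real.exp (-γ * r))) := fun r hr i => by
    refine (norm_sum_le _ _).trans ((Finset.sum_le_sum (g := fun _ =>
      W * (c * Real.exp (-γ * r))) fun j _ => ?_).trans_eq (by simp [hn]))
    rw [norm_smul]
    exact mul_le_mul (hwt _ _ (hxR r hr) (hxR r hr) i j).1 (hqc r hr i j) (norm_nonneg _) hW
  have hexp : ∀ r, s ≤ r → Real.exp (-γ * r) ≤ Real.exp (-γ * s) := fun r hr =>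
    Real.exp_le_exp.2 (by nlinarith)
  have hexp1 : ∀ r, 0 ≤ r → Real.exp (-γ * r) ≤ 1 := fun r hr =>
    Real.exp_le_one_iff.2 (by nlinarith)
  have hsub : Set.Icc s t ⊆ Set.Icc 0 b := Set.Icc_subset_Icc hs htb
  have hsub' : Set.Ico s t ⊆ Set.Ico 0 b := Set.Ico_subset_Ico hs htb
  set ε := Real.exp (-γ * s) with hε
  have hε0 : 0 < ε := Real.exp_pos _
  -- Mean value inequality, with the decaying slope bounded on `[s, t]` by its value at `s`.
  have hdx : ∀ i j, ‖(x t i - x t j) - (x s i - x s j)‖ ≤ c * ε * (t - s) := fun i j =>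
    norm_image_sub_le_of_norm_deriv_right_le_segment
      (f := fun r => x r i - x r j) (f' := fun r => q r i - q r j)
      (((h.cont_x i).sub (h.cont_x j)).mono hsub)
      (fun r hr => (h.deriv_x i r (hsub' hr)).sub (h.deriv_x j r (hsub' hr)))
      (fun r hr => (hqc r (hsub (Set.Ico_subset_Icc_self hr)) i j).trans
        (mul_le_mul_of_nonneg_left (hexp r hr.1) hc.le)) t ⟨hst, le_rfl⟩
  have hdq : ∀ i j, ‖(q t i - q t j) - (q s i - q s j)‖ ≤ K₁ * ε * (t - s) := fun i j => by
    refine norm_image_sub_le_of_norm_deriv_right_le_segment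
      (f := fun r => q r i - q r j)
      (((h.cont_q i).sub (h.cont_q j)).mono hsub)
      (fun r hr => (h.deriv_q i r (hsub' hr)).sub (h.deriv_q j r (hsub' hr)))
      (fun r hr => ?_) t ⟨hst, le_rfl⟩
    have hr' := hsub (Set.Ico_subset_Icc_self hr)
    have e1 : ∀ i, ‖e r i‖ ≤ g.α * Real.exp (-γ * r) := fun i =>
      (h.err i r (hsub' hr)).trans (mul_le_mul_of_nonneg_left
        (Real.exp_le_exp.2 (by nlinarith [hr'.1])) hα.le)
    have e2 : ∀ i, ‖-(g.k₁ • N.posFeedback (x r) i) - g.k₂ • N.velFeedback (x r) (q r) i + e r i‖ ≤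
        g.k₁ * (n * (W * (c * Real.exp (-γ * r)))) + g.k₂ * (n * (W * (c * Real.exp (-γ * r)))) +
          g.α * Real.exp (-γ * r) := fun i => by
      refine (norm_add_le _ _).trans (add_le_add ((norm_sub_le _ _).trans ?_) (e1 i))
      rw [norm_neg, norm_smul, norm_smul, Real.norm_of_nonneg hk₁.le, Real.norm_of_nonneg hk₂.le]
      exact add_le_add (mul_le_mul_of_nonneg_left (hpf r hr' i) hk₁.le)
        (mul_le_mul_of_nonneg_left (hvf r hr' i) hk₂.le)
    have e3 : -(g.k₁ • N.posFeedback (x r) i) - g.k₂ • N.velFeedback (x r) (q r) i -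
        g.k₃ • q r i + e r i - (-(g.k₁ • N.posFeedback (x r) j) -
        g.k₂ • N.velFeedback (x r) (q r) j - g.k₃ • q r j + e r j) =
        (-(g.k₁ • N.posFeedback (x r) i) - g.k₂ • N.velFeedback (x r) (q r) i + e r i) -
        (-(g.k₁ • N.posFeedback (x r) j) - g.k₂ • N.velFeedback (x r) (q r) j + e r j) -
        g.k₃ • (q r i - q r j) := by module
    have e4 : ‖g.k₃ • (q r i - q r j)‖ ≤ g.k₃ * (c * Real.exp (-γ * r)) := by
      rw [norm_smul, Real.norm_of_nonneg hk₃.le]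
      exact mul_le_mul_of_nonneg_left (hqc r hr' i j) hk₃.le
    rw [e3]
    calc _ ≤ _ := (norm_sub_le _ _).trans (add_le_add_left (norm_sub_le _ _) _)
      _ ≤ K₁ * Real.exp (-γ * r) := by
        have := e2 i
        have := e2 j
        rw [hK₁]
        linarith
      _ ≤ K₁ * ε := mul_le_mul_of_nonneg_left (hexp r hr.1) hK₁0
  have hts : 0 ≤ t - s := sub_nonneg.2 hst
  have ht' : t ∈ Set.Icc 0 b := ⟨hs.trans hst, htb⟩
  have hs' : s ∈ Set.Icc 0 b := ⟨hs, hst.trans htb⟩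
  have hw' : ∀ j, |N.weight (x t) i j - N.weight (x s) i j| ≤ L * (c * ε * (t - s)) := fun j =>
    (hwt _ _ (hxR t ht') (hxR s hs') i j).2.trans (mul_le_mul_of_nonneg_left (hdx i j) hL)
  have hc1 : c * Real.exp (-γ * t) ≤ c := mul_le_of_le_one_right hc.le (hexp1 t ht'.1)
  have hEpf : ‖N.posFeedback (x t) i - N.posFeedback (x s) i‖ ≤
      n * (L * (c * ε * (t - s)) * c + W * (c * ε * (t - s))) := by
    rw [Network.posFeedback, Network.posFeedback, ← Finset.sum_sub_distrib]
    refine (norm_sum_le _ _).trans ((Finset.sum_le_sum (g := fun _ =>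
      L * (c * ε * (t - s)) * c + W * (c * ε * (t - s))) fun j _ => ?_).trans_eq
      (by rw [Finset.sum_const, Finset.card_univ, nsmul_eq_mul]))
    by_cases hij : N.graph.Adj i j
    · refine norm_smul_sub_smul_le (hw' j) ((hxc t ht' i j hij).trans hc1)
        (hwt _ _ (hxR s hs') (hxR s hs') i j).1 ?_
      rw [sub_sub_sub_cancel_right]
      exact hdx i j
    · rw [weight_of_not_adj hij, weight_of_not_adj hij, zero_smul, zero_smul, sub_zero, norm_zero]
      positivity
  have hEvf : ‖N.velFeedback (x t) (q t) i - N.velFeedback (x s) (q s) i‖ ≤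
      n * (L * (c * ε * (t - s)) * c + W * (K₁ * ε * (t - s))) := by
    rw [Network.velFeedback, Network.velFeedback, ← Finset.sum_sub_distrib]
    refine (norm_sum_le _ _).trans ((Finset.sum_le_sum (g := fun _ =>
      L * (c * ε * (t - s)) * c + W * (K₁ * ε * (t - s))) fun j _ => ?_).trans_eq
      (by rw [Finset.sum_const, Finset.card_univ, nsmul_eq_mul]))
    exact norm_smul_sub_smul_le (hw' j) ((hqc t ht' i j).trans hc1)
      (hwt _ _ (hxR s hs') (hxR s hs') i j).1 (hdq i j)
  rw [triggerError]
  refine (norm_add_le _ _).trans ?_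
  rw [norm_smul, norm_smul, Real.norm_of_nonneg hk₁.le, Real.norm_of_nonneg hk₂.le]
  have h1 := mul_le_mul_of_nonneg_left hEpf hk₁.le
  have h2 := mul_le_mul_of_nonneg_left hEvf hk₂.le
  have h3 : 0 ≤ ε * (t - s) := by positivity
  linarith

end Lipschitz

/-! ### Damped motion under a constant input -/

section HeldInput

variable {F : Type*} [NormedAddCommGroup F] [NormedSpace ℝ F]

/-- Motion of a damped double integrator under a constant input. -/
lemma exists_held_motion {k : ℝ} (hk : 0 < k) (c x₀ q₀ : F) (σ : ℝ) :
    ∃ X Q : ℝ → F, (∀ t, HasDerivAt X (Q t) t) ∧ (∀ t, HasDerivAt Q (c - k • Q t) t) ∧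
      X σ = x₀ ∧ Q σ = q₀ := by
  have he : ∀ t, HasDerivAt (fun t => Real.exp (-k * (t - σ)))
      (Real.exp (-k * (t - σ)) * -k) t := fun t => by
    simpa using (((hasDerivAt_id t).sub_const σ).const_mul (-k)).exp
  set u := q₀ - (1 / k) • c with hu
  refine ⟨fun t => x₀ + ((t - σ) • ((1 / k) • c) + ((1 - Real.exp (-k * (t - σ))) / k) • u),
    fun t => (1 / k) • c + Real.exp (-k * (t - σ)) • u, fun t => ?_, fun t => ?_, ?_, ?_⟩
  · refine (((((hasDerivAt_id t).sub_const σ).smul_const ((1 / k) • c)).add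
      ((((he t).const_sub 1).div_const k).smul_const u)).const_add x₀).congr_deriv ?_
    rw [one_smul]
    congr 2
    field_simp
  · refine (((he t).smul_const u).const_add ((1 / k) • c)).congr_deriv ?_
    rw [smul_add, smul_smul, mul_one_div_cancel hk.ne', one_smul, sub_add_cancel_left, smul_smul,
      mul_neg, neg_smul, mul_comm]
  · simp
  · simp [hu]

/-- The integrating factor makes `e^{kt} (q - Q)` constant, hence zero; then `x` and `X` have the
same right derivative. -/
lemma held_motion_unique {k : ℝ} {c : F} {X Q x q : ℝ → F} {σ b : ℝ}
    (hX : ∀ t, HasDerivAt X (Q t) t) (hQ : ∀ t, HasDerivAt Q (c - k • Q t) t)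
    (hxc : ContinuousOn x (Set.Icc σ b)) (hqc : ContinuousOn q (Set.Icc σ b))
    (hx : ∀ t ∈ Set.Ico σ b, HasDerivWithinAt x (q t) (Set.Ici t) t)
    (hq : ∀ t ∈ Set.Ico σ b, HasDerivWithinAt q (c - k • q t) (Set.Ici t) t)
    (hx0 : X σ = x σ) (hq0 : Q σ = q σ) :
    ∀ t ∈ Set.Icc σ b, x t = X t ∧ q t = Q t := by
  have hQc : Continuous Q := continuous_iff_continuousAt.2 fun t => (hQ t).continuousAt
  have hXc : Continuous X := continuous_iff_continuousAt.2 fun t => (hX t).continuousAt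
  have he : ∀ t, HasDerivAt (fun t => Real.exp (k * t)) (Real.exp (k * t) * k) t := fun t => by
    simpa using ((hasDerivAt_id t).const_mul k).exp
  have hqQ : ∀ t ∈ Set.Icc σ b, q t = Q t := by
    intro t ht
    have h1 := constant_of_has_deriv_right_zero (f := fun t => Real.exp (k * t) • (q t - Q t))
      (a := σ) (b := b)
      ((Continuous.continuousOn (by fun_prop)).smul (hqc.sub hQc.continuousOn))
      (fun t ht => by
        refine ((he t).hasDerivWithinAt.smul
          ((hq t ht).sub (hQ t).hasDerivWithinAt)).congr_deriv ?_
        simp only [Pi.sub_apply]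
        module) t ht
    simp only [hq0, sub_self, smul_zero] at h1
    have h2 := (smul_eq_zero.1 h1).resolve_left (Real.exp_pos _).ne'
    exact sub_eq_zero.1 h2
  refine fun t ht => ⟨?_, hqQ t ht⟩
  refine eq_of_has_deriv_right_eq hx (fun s hs => ?_) hxc hXc.continuousOn hx0.symm t ht
  rw [hqQ s (Set.Ico_subset_Icc_self hs)]
  exact (hX s).hasDerivWithinAt

end HeldInput

/-! ### Continuation beyond a finite time -/

section Continuation

variable {V : Type*} [Fintype V] {p : ℕ} {N : Network V p} {g : Gains}
  {x q : ℝ → V → EuclideanSpace ℝ (Fin p)} {S : V → Set ℝ}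

lemma continuousAt_triggerError {T : ℝ} (hx : ∀ i, ContinuousAt (fun t => x t i) T)
    (hq : ∀ i, ContinuousAt (fun t => q t i) T) (hok : N.InitialOK (x T)) (i : V) (s : ℝ) :
    ContinuousAt (fun t => triggerError N g x q i s t) T := by
  have hw : ∀ j, ContinuousAt (fun t => N.weight (x t) i j) T := fun j => by
    by_cases hij : N.graph.Adj i j
    · have hn : ContinuousAt (fun t => ‖x t i - x t j - N.d i j‖) T :=
        (((hx i).sub (hx j)).sub continuousAt_const).norm
      simp only [weight_of_adj hij, weightFun]
      exact (continuousAt_const.sub hn).div ((continuousAt_const.sub hn).pow 2)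
        (pow_ne_zero 2 (sub_pos.2 (hok i j hij)).ne')
    · simp only [weight_of_not_adj hij]
      exact continuousAt_const
  have h1 : ContinuousAt (fun t => N.posFeedback (x t) i) T :=
    tendsto_finsetSum _ fun j _ => (hw j).smul (((hx i).sub (hx j)).sub continuousAt_const)
  have h2 : ContinuousAt (fun t => N.velFeedback (x t) (q t) i) T :=
    tendsto_finsetSum _ fun j _ => (hw j).smul ((hq i).sub (hq j))
  exact ((h1.sub continuousAt_const).const_smul g.k₁).add
    ((h2.sub continuousAt_const).const_smul g.k₂)

lemma triggerError_congr {x' q' : ℝ → V → EuclideanSpace ℝ (Fin p)} {s t : ℝ}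
    (hxs : x' s = x s) (hqs : q' s = q s) (hxt : x' t = x t) (hqt : q' t = q t) (i : V) :
    triggerError N g x' q' i s t = triggerError N g x q i s t := by
  rw [triggerError, triggerError, hxs, hqs, hxt, hqt]

/-- After the last triggering time, an execution follows a smooth motion defined for all times. -/
lemma IsExecution.exists_smooth_motion [Nonempty V] {T : ℝ} (h : IsExecution N g T x q S)
    (hfin : ∀ i, (S i).Finite) (hk₃ : 0 < g.k₃) :
    ∃ σ, 0 ≤ σ ∧ σ < T ∧ ∃ X Q : ℝ → V → EuclideanSpace ℝ (Fin p),
      (∀ i t, HasDerivAt (fun r => X r i) (Q t i) t) ∧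
      (∀ i, Continuous fun r => Q r i) ∧
      ∀ t, σ ≤ t → t < T → x t = X t ∧ q t = Q t := by
  have hT : 0 < T := by exact_mod_cast h.pos
  have hST : ∀ i, ∀ s ∈ S i, 0 ≤ s ∧ s < T := fun i s hs =>
    ⟨(h.mem_range i s hs).1, by exact_mod_cast (h.mem_range i s hs).2⟩
  have hmem : ∀ i, lastTrigger (S i) T ∈ S i := fun i =>
    (FormationControl.lastTrigger_mem (h.zero_mem i) hT.le ((hfin i).inter_of_left _)).1
  -- After the latest of the last triggering times no agent updates any more, so all held inputs are
  -- constant.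
  obtain ⟨i₀, hi₀⟩ := Finite.exists_max fun i => lastTrigger (S i) T
  set σ := lastTrigger (S i₀) T with hσ
  obtain ⟨hσ0, hσT⟩ := hST i₀ σ (hmem i₀)
  set c : V → EuclideanSpace ℝ (Fin p) := fun i =>
    -(g.k₁ • N.posFeedback (x (lastTrigger (S i) T)) i) -
      g.k₂ • N.velFeedback (x (lastTrigger (S i) T)) (q (lastTrigger (S i) T)) i with hc
  choose X Q hX hQ hX0 hQ0 using fun i => exists_held_motion hk₃ (c i) (x σ i) (q σ i) σ
  refine ⟨σ, hσ0, hσT, fun t i => X i t, fun t i => Q i t, fun i t => hX i t, fun i =>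
    continuous_iff_continuousAt.2 fun t => (hQ i t).continuousAt, fun t hσt htT => ?_⟩
  have hcl := h.isClosedLoop (b := t) (by exact_mod_cast htT)
  have hsub : Set.Icc σ t ⊆ Set.Icc 0 t := Set.Icc_subset_Icc_left hσ0
  have hsub' : Set.Ico σ t ⊆ Set.Ico 0 t := Set.Ico_subset_Ico_left hσ0
  have key : ∀ i, x t i = X i t ∧ q t i = Q i t := fun i => by
    refine held_motion_unique (hX i) (hQ i) ((hcl.cont_x i).mono hsub) ((hcl.cont_q i).mono hsub)
      (fun r hr => hcl.deriv_x i r (hsub' hr)) (fun r hr => ?_) (hX0 i) (hQ0 i) t ⟨hσt, le_rfl⟩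
    have h1 := h.deriv_q i r (hσ0.trans hr.1) (by exact_mod_cast hr.2.trans htT)
    have h2 : lastTrigger (S i) r = lastTrigger (S i) T :=
      lastTrigger_eq (hmem i) ((hi₀ i).trans hr.1) fun u hu hlt =>
        absurd (le_lastTrigger hu (hST i u hu).2.le) hlt.not_ge
    rw [controlInput, h2] at h1
    exact h1
  exact ⟨funext fun i => (key i).1, funext fun i => (key i).2⟩

/-- An execution on a bounded interval with finitely many triggering times, whose configurations
stay uniformly admissible, can be continued. -/
lemma IsExecution.exists_continuation [Nonempty V] {T : ℝ} (h : IsExecution N g T x q S)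
    (hfin : ∀ i, (S i).Finite) (hk₃ : 0 < g.k₃) (hα : 0 < g.α) {R : V → V → ℝ}
    (hR : ∀ i j, N.graph.Adj i j → R i j < N.Δ - ‖N.d i j‖)
    (hxR : ∀ t, 0 ≤ t → t < T → ∀ i j, N.graph.Adj i j → ‖x t i - x t j - N.d i j‖ ≤ R i j) :
    ∃ (T' : EReal) (x' q' : ℝ → V → EuclideanSpace ℝ (Fin p)) (S' : V → Set ℝ),
      (T : EReal) < T' ∧ IsExecution N g T' x' q' S' ∧
      (∀ t : ℝ, 0 ≤ t → (t : EReal) < T → x' t = x t ∧ q' t = q t) ∧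
      (∀ i, ∀ t : ℝ, (t : EReal) < T → (t ∈ S' i ↔ t ∈ S i)) := by
  classical
  have hT : 0 < T := by exact_mod_cast h.pos
  have hST : ∀ i, ∀ s ∈ S i, 0 ≤ s ∧ s < T := fun i s hs =>
    ⟨(h.mem_range i s hs).1, by exact_mod_cast (h.mem_range i s hs).2⟩
  obtain ⟨σ, hσ0, hσT, X, Q, hX, hQ, hXQ⟩ := h.exists_smooth_motion hfin hk₃
  set l : V → ℝ := fun i => lastTrigger (S i) T with hl
  have hlmem : ∀ i, l i ∈ S i := fun i =>
    (FormationControl.lastTrigger_mem (h.zero_mem i) hT.le ((hfin i).inter_of_left _)).1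
  have hlmax : ∀ i, ∀ s ∈ S i, s ≤ l i := fun i s hs => le_lastTrigger hs (hST i s hs).2.le
  -- the data at time `T`
  set pT : V → EuclideanSpace ℝ (Fin p) := fun i => N.posFeedback (X T) i with hpT
  set vT : V → EuclideanSpace ℝ (Fin p) := fun i => N.velFeedback (X T) (Q T) i with hvT
  -- Agents whose error reaches the threshold exactly at `T` are updated there; the others have
  -- strict slack at `T` and keep their data.
  set fired : V → Prop := fun i =>
    ‖g.k₁ • (pT i - N.posFeedback (x (l i)) i) +
      g.k₂ • (vT i - N.velFeedback (x (l i)) (q (l i)) i)‖ = g.α * Real.exp (-g.β * T) with hfired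
  set c : V → EuclideanSpace ℝ (Fin p) := fun i =>
    if fired i then -(g.k₁ • pT i) - g.k₂ • vT i else
      -(g.k₁ • N.posFeedback (x (l i)) i) - g.k₂ • N.velFeedback (x (l i)) (q (l i)) i with hc
  choose Y W hY hW hY0 hW0 using fun i => exists_held_motion hk₃ (c i) (X T i) (Q T i) T
  set x' : ℝ → V → EuclideanSpace ℝ (Fin p) := fun t => if t < T then x t else fun i => Y i t
    with hx'
  set q' : ℝ → V → EuclideanSpace ℝ (Fin p) := fun t => if t < T then q t else fun i => W i t
    with hq'
  have hxlt : ∀ t, t < T → x' t = x t := fun t ht => if_pos ht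
  have hqlt : ∀ t, t < T → q' t = q t := fun t ht => if_pos ht
  have hxge : ∀ t, T ≤ t → x' t = fun i => Y i t := fun t ht => if_neg ht.not_gt
  have hqge : ∀ t, T ≤ t → q' t = fun i => W i t := fun t ht => if_neg ht.not_gt
  have hxT : x' T = X T := by rw [hxge T le_rfl]; exact funext hY0
  have hqT : q' T = Q T := by rw [hqge T le_rfl]; exact funext hW0
  have hleft : ∀ t ∈ Set.Ioc σ T, x' t = X t ∧ q' t = Q t := fun t ht => by
    rcases ht.2.eq_or_lt with rfl | hlt
    · exact ⟨hxT, hqT⟩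
    · rw [hxlt t hlt, hqlt t hlt]
      exact hXQ t ht.1.le hlt
  have hnl : Set.Ioc σ T ∈ 𝓝[≤] T := Ioc_mem_nhdsLE hσT
  -- The positions need a two-sided derivative at `T`: the old smooth motion supplies the left one
  -- and the new motion the right one, with equal velocities.
  have hderT : ∀ i, HasDerivAt (fun r => x' r i) (q' T i) T := fun i => by
    have h1 : HasDerivWithinAt (fun r => x' r i) (q' T i) (Set.Iic T) T := by
      rw [hqT]
      refine (hX i T).hasDerivWithinAt.congr_of_eventuallyEq ?_ (by rw [hxT])
      filter_upwards [hnl] with t ht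
      rw [(hleft t ht).1]
    have h2 : HasDerivWithinAt (fun r => x' r i) (q' T i) (Set.Ici T) T := by
      rw [hqge T le_rfl]
      exact (hY i T).hasDerivWithinAt.congr (fun t ht => by rw [hxge t ht])
        (by rw [hxge T le_rfl])
    have h3 := h1.union h2
    rwa [Set.Iic_union_Ici, hasDerivWithinAt_univ] at h3
  have hcontT : ∀ i, ContinuousAt (fun r => q' r i) T := fun i => by
    rw [continuousAt_iff_continuous_left_right]
    constructor
    · refine ((hQ i).continuousWithinAt).congr_of_eventuallyEq ?_ (by rw [hqT])
      filter_upwards [hnl] with t ht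
      rw [(hleft t ht).2]
    · exact ((hW i T).continuousAt.continuousWithinAt).congr (fun t ht => by rw [hqge t ht])
        (by rw [hqge T le_rfl])
  have hderlt : ∀ i t, 0 ≤ t → t < T →
      HasDerivWithinAt (fun r => x' r i) (q' t i) (Set.Ici 0) t := fun i t h0 ht => by
    rw [hqlt t ht]
    refine (h.deriv_x i t h0 (by exact_mod_cast ht)).congr_of_eventuallyEq ?_ (by rw [hxlt t ht])
    filter_upwards [mem_nhdsWithin_of_mem_nhds (Iio_mem_nhds ht)] with r hr
    rw [hxlt r hr]
  have hdergt : ∀ i t, T < t → HasDerivAt (fun r => x' r i) (q' t i) t := fun i t ht => by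
    rw [hqge t ht.le]
    refine (hY i t).congr_of_eventuallyEq ?_
    filter_upwards [Ioi_mem_nhds ht] with r hr
    rw [hxge r (le_of_lt hr)]
  have hcontgt : ∀ i t, T < t → ContinuousAt (fun r => q' r i) t := fun i t ht => by
    refine (hW i t).continuousAt.congr_of_eventuallyEq ?_
    filter_upwards [Ioi_mem_nhds ht] with r hr
    rw [hqge r (le_of_lt hr)]
  have hnlt : (𝓝[<] T).NeBot := inferInstance
  have hIoo : Set.Ioo σ T ∈ 𝓝[<] T := Ioo_mem_nhdsLT hσT
  have hokT : N.InitialOK (x' T) := fun i j hij => by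
    have h1 : Tendsto (fun t => ‖x' t i - x' t j - N.d i j‖) (𝓝[<] T)
        (𝓝 ‖x' T i - x' T j - N.d i j‖) :=
      (((hderT i).continuousAt.sub (hderT j).continuousAt).sub
        continuousAt_const).norm.tendsto.mono_left nhdsWithin_le_nhds
    refine (le_of_tendsto h1 ?_).trans_lt (hR i j hij)
    filter_upwards [hIoo] with t ht
    rw [hxlt t ht.2]
    exact hxR t (hσ0.trans ht.1.le) ht.2 i j hij
  have hEcont : ∀ i s, ContinuousAt (fun t => triggerError N g x' q' i s t) T := fun i s =>
    continuousAt_triggerError (fun i => (hderT i).continuousAt) hcontT hokT i s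
  have hEfired : ∀ i, fired i ↔
      ‖triggerError N g x' q' i (l i) T‖ = g.α * Real.exp (-g.β * T) := fun i => by
    have hli := (hST i _ (hlmem i)).2
    rw [triggerError, hxT, hqT, hxlt _ hli, hqlt _ hli]
  have hbT : Tendsto (fun t => g.α * Real.exp (-g.β * t)) (𝓝 T)
      (𝓝 (g.α * Real.exp (-g.β * T))) :=
    Continuous.tendsto (f := fun t => g.α * Real.exp (-g.β * t)) (by fun_prop) T
  have hEle : ∀ i, ‖triggerError N g x' q' i (l i) T‖ ≤ g.α * Real.exp (-g.β * T) := fun i => by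
    have hli := (hST i _ (hlmem i)).2
    refine le_of_tendsto_of_tendsto ((hEcont i (l i)).norm.tendsto.mono_left nhdsWithin_le_nhds)
      (hbT.mono_left nhdsWithin_le_nhds) (?_ : _ ≤ᶠ[𝓝[<] T] _)
    filter_upwards [Ioo_mem_nhdsLT hli] with t ht
    rw [triggerError_congr (hxlt _ hli) (hqlt _ hli) (hxlt _ ht.2) (hqlt _ ht.2)]
    exact h.bound i _ (hlmem i) t ht.1.le (by exact_mod_cast ht.2) fun r hr hlt =>
      absurd (hlmax i r hr) hlt.not_ge
  set l' : V → ℝ := fun i => if fired i then T else l i with hl'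
  -- At `T` the error is zero for updated agents and strictly below the threshold for the others;
  -- continuity provides the length `ε` of the continuation.
  have hEev : ∀ᶠ t in 𝓝 T, ∀ i,
      ‖triggerError N g x' q' i (l' i) t‖ < g.α * Real.exp (-g.β * t) := by
    rw [eventually_all]
    intro i
    refine (hEcont i (l' i)).norm.tendsto.eventually_lt hbT ?_
    by_cases hf : fired i
    · have : triggerError N g x' q' i T T = 0 := by simp [triggerError]
      simp only [hl', if_pos hf, this, norm_zero]
      positivity
    · simp only [hl', if_neg hf]
      exact lt_of_le_of_ne (hEle i) fun he => hf ((hEfired i).2 he)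
  obtain ⟨ε, hε, hball⟩ := Metric.eventually_nhds_iff.1 hEev
  have hEbound : ∀ t, T ≤ t → t < T + ε → ∀ i,
      ‖triggerError N g x' q' i (l' i) t‖ ≤ g.α * Real.exp (-g.β * t) := fun t h1 h2 i =>
    (hball (by rw [Real.dist_eq, abs_of_nonneg (by linarith)]; linarith) i).le
  set S' : V → Set ℝ := fun i => {t | t ∈ S i ∨ (t = T ∧ fired i)} with hS'
  have hS'lt : ∀ i t, t < T → (t ∈ S' i ↔ t ∈ S i) := fun i t ht =>
    ⟨fun hm => hm.resolve_right fun hm => ht.ne hm.1, Or.inl⟩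
  have hS'T : ∀ i, fired i → T ∈ S' i := fun i hf => Or.inr ⟨rfl, hf⟩
  have hS'le : ∀ i, ∀ t ∈ S' i, t ≤ l' i := fun i t ht => by
    by_cases hf : fired i
    · simp only [hl', if_pos hf]
      rcases ht with ht | ht
      · exact (hST i t ht).2.le
      · exact ht.1.le
    · simp only [hl', if_neg hf]
      exact hlmax i t (ht.resolve_right fun h => hf h.2)
  have hl'mem : ∀ i, l' i ∈ S' i := fun i => by
    by_cases hf : fired i
    · simp only [hl', if_pos hf]
      exact hS'T i hf
    · simp only [hl', if_neg hf]
      exact Or.inl (hlmem i)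
  have hl'T : ∀ i, l' i ≤ T := fun i => by
    by_cases hf : fired i
    · simp only [hl', if_pos hf, le_refl]
    · simp only [hl', if_neg hf]
      exact (hST i _ (hlmem i)).2.le
  have hlast : ∀ i t, T ≤ t → lastTrigger (S' i) t = l' i := fun i t ht =>
    lastTrigger_eq (hl'mem i) ((hl'T i).trans ht) fun r hr hlt =>
      absurd (hS'le i r hr) hlt.not_ge
  have hlastlt : ∀ i t, t < T → lastTrigger (S' i) t = lastTrigger (S i) t := fun i t ht => by
    rw [lastTrigger, lastTrigger]
    congr 1
    ext r
    exact and_congr_left fun hr => hS'lt i r (lt_of_le_of_lt hr ht)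
  have hctrl : ∀ i t, T ≤ t → controlInput N g x' q' (S' i) i t = c i - g.k₃ • W i t := by
    intro i t ht
    rw [controlInput, hlast i t ht, hqge t ht]
    by_cases hf : fired i
    · simp only [hl', hc, if_pos hf, hxT, hqT, hpT, hvT]
    · have hli := (hST i _ (hlmem i)).2
      simp only [hl', hc, if_neg hf, hxlt _ hli, hqlt _ hli]
  refine ⟨((T + ε : ℝ) : EReal), x', q', S', EReal.coe_lt_coe_iff.2 (by linarith),
    { pos := ?_, zero_mem := ?_, mem_range := ?_, finite := ?_, deriv_x := ?_, cont_q := ?_,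
      deriv_q := ?_, bound := ?_, fire := ?_ },
    fun t _ ht => ⟨hxlt t (by exact_mod_cast ht), hqlt t (by exact_mod_cast ht)⟩,
    fun i t ht => hS'lt i t (by exact_mod_cast ht)⟩
  · exact_mod_cast (by linarith : 0 < T + ε)
  · exact fun i => Or.inl (h.zero_mem i)
  · rintro i s (hs | ⟨rfl, -⟩)
    · exact ⟨(hST i s hs).1, EReal.coe_lt_coe_iff.2 (by linarith [(hST i s hs).2])⟩
    · exact ⟨hT.le, EReal.coe_lt_coe_iff.2 (by linarith)⟩
  · intro i t _
    refine (((hfin i).insert T).subset fun s hs => ?_)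
    exact hs.1.elim (fun h => Or.inr h) fun h => Or.inl h.1
  · intro i t h0 _
    rcases lt_trichotomy t T with ht | rfl | ht
    · exact hderlt i t h0 ht
    · exact (hderT i).hasDerivWithinAt
    · exact (hdergt i t ht).hasDerivWithinAt
  · intro i t ht
    rcases lt_trichotomy t T with hlt | rfl | hlt
    · have h1 := h.cont_q i t ⟨ht.1, by exact_mod_cast hlt⟩
      have h2 : ContinuousWithinAt (fun r => q' r i) {t : ℝ | 0 ≤ t ∧ (t : EReal) < T} t := by
        refine h1.congr (fun r hr => ?_) (by rw [hqlt t hlt])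
        rw [hqlt r (by exact_mod_cast hr.2)]
      refine h2.mono_of_mem_nhdsWithin ?_
      filter_upwards [self_mem_nhdsWithin, mem_nhdsWithin_of_mem_nhds (Iio_mem_nhds hlt)]
        with r hr hrT
      exact ⟨hr.1, EReal.coe_lt_coe_iff.2 hrT⟩
    · exact (hcontT i).continuousWithinAt
    · exact (hcontgt i t hlt).continuousWithinAt
  · intro i t h0 _
    rcases lt_or_ge t T with ht | ht
    · have h1 := h.deriv_q i t h0 (by exact_mod_cast ht)
      have h2 : controlInput N g x' q' (S' i) i t = controlInput N g x q (S i) i t := by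
        have h3 := (h.lastTrigger_mem i h0 (by exact_mod_cast ht)).2
        have h4 : lastTrigger (S i) t < T := lt_of_le_of_lt h3 ht
        rw [controlInput, controlInput, hlastlt i t ht, hxlt _ h4, hqlt _ h4, hqlt t ht]
      rw [h2]
      refine h1.congr_of_eventuallyEq ?_ (by rw [hqlt t ht])
      filter_upwards [mem_nhdsWithin_of_mem_nhds (Iio_mem_nhds ht)] with r hr
      rw [hqlt r hr]
    · rw [hctrl i t ht]
      exact (hW i t).hasDerivWithinAt.congr
        (fun r hr => by rw [hqge r (ht.trans hr)]) (by rw [hqge t ht])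
  · intro i s hs t hst htT' hnext
    have htT' : t < T + ε := by exact_mod_cast htT'
    rcases lt_or_ge t T with ht | ht
    · have hsT := lt_of_le_of_lt hst ht
      rw [triggerError_congr (hxlt s hsT) (hqlt s hsT) (hxlt t ht) (hqlt t ht)]
      exact h.bound i s ((hS'lt i s hsT).1 hs) t hst (by exact_mod_cast ht)
        fun r hr => hnext r (Or.inl hr)
    · rcases (hS'le i s hs).eq_or_lt with heq | hlt
      · rw [heq]
        exact hEbound t ht htT' i
      -- If `s` precedes the last update although `t ≥ T`, that update and `t` are both `T`, and `s`
      -- is the last old triggering time.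
      · have h1 := hnext _ (hl'mem i) hlt
        have h2 : t = T := le_antisymm (h1.trans (hl'T i)) ht
        have h3 : l' i = T := le_antisymm (hl'T i) (ht.trans h1)
        have hsT : s < T := by rwa [h3] at hlt
        have hsS := (hS'lt i s hsT).1 hs
        have h4 : s = l i := by
          refine le_antisymm (hlmax i s hsS) (not_lt.1 fun hsl => ?_)
          have := hnext _ (Or.inl (hlmem i)) hsl
          exact ((hST i _ (hlmem i)).2.trans_le ht).not_ge this
        rw [h2, h4]
        exact hEle i
  · rintro i s s' ⟨hs, hs', hss', hnext⟩
    rcases hs' with hs' | ⟨rfl, hf⟩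
    · have hs'T := (hST i s' hs').2
      have hsT := hss'.trans hs'T
      rw [triggerError_congr (hxlt s hsT) (hqlt s hsT) (hxlt s' hs'T) (hqlt s' hs'T)]
      exact h.fire i s s' ⟨(hS'lt i s hsT).1 hs, hs', hss', fun r hr => hnext r (Or.inl hr)⟩
    · have hsS := (hS'lt i s hss').1 hs
      have h4 : s = l i := by
        refine le_antisymm (hlmax i s hsS) (not_lt.1 fun hsl => ?_)
        exact (hST i _ (hlmem i)).2.not_ge (hnext _ (Or.inl (hlmem i)) hsl)
      rw [h4]
      exact (hEfired i).1 hf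

end Continuation

/-! ### Estimates along executions and minimal gaps -/

section Estimates

variable {V : Type*} [Fintype V] {p : ℕ} {N : Network V p} {g : Gains}

/-- The rate `γ` is attained by the disagreements of all executions with the given initial state,
with a constant that depends on the initial state only. -/
def HasDecayRate (N : Network V p) (g : Gains) (γ : ℝ) : Prop :=
  ∀ x₀ q₀ : V → EuclideanSpace ℝ (Fin p), N.InitialOK x₀ →
    ∃ (c K : ℝ) (R : V → V → ℝ), 0 < c ∧ 0 < K ∧
      (∀ i j, N.graph.Adj i j → R i j < N.Δ - ‖N.d i j‖) ∧
      ∀ (T : EReal) (x q : ℝ → V → EuclideanSpace ℝ (Fin p)) (S : V → Set ℝ),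
        IsExecution N g T x q S → x 0 = x₀ → q 0 = q₀ →
        (∀ t : ℝ, 0 ≤ t → (t : EReal) < T → ∀ i j, N.graph.Adj i j →
          ‖x t i - x t j - N.d i j‖ ≤ R i j ∧
          ‖x t i - x t j - N.d i j‖ ≤ c * Real.exp (-γ * t)) ∧
        (∀ t : ℝ, 0 ≤ t → (t : EReal) < T → ∀ i j, ‖q t i - q t j‖ ≤ c * Real.exp (-γ * t)) ∧
        (∀ i s s', IsNextTrigger (S i) s s' →
          g.α * Real.exp (-g.β * s') ≤ K * Real.exp (-γ * s) * (s' - s))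

lemma hasDecayRate [Nontrivial V] (hconn : N.graph.Connected)
    (hfeas : N.Feasible) (hd : ∀ i j, N.graph.Adj i j → ‖N.d i j‖ < N.Δ)
    {β₁ k₀ l : ℝ} {P C : Matrix (Fin 2) (Fin 2) ℝ} {B : Matrix (Fin 2) (Fin 1) ℝ}
    (hC : C = !![0, 1; 0, 0]) (hB : B = !![0; 1])
    (hβ₁ : 0 < β₁) (hβ₁' : β₁ ≤ N.β₀)
    (hk₀ : 0 < k₀) (hk₁ : 0 < g.k₁) (hk₂ : 0 < g.k₂)
    (hP : P = !![k₀, g.k₁; g.k₁, g.k₂]) (hPpos : P.PosDef)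
    (hRiccati : (-((1 / 2 : ℝ) • (P * C + Cᵀ * P) - β₁ • (P * B * Bᵀ * P)
      + (2 : ℝ) • (1 : Matrix (Fin 2) (Fin 2) ℝ))).PosSemidef)
    (hk₃ : 0 < g.k₃) (hk₄ : g.k₃ * ((g.k₂ + √(g.k₁ ^ 2 + g.k₂ ^ 2)) / 2) < 2)
    (hα : 0 < g.α) (hβ : 0 < g.β)
    (hl : 0 < l) (hl₀ : k₀ ≤ l) (hl₂ : g.k₂ ≤ l) (hldet : g.k₁ ^ 2 ≤ (l - k₀) * (l - g.k₂))
    {γ : ℝ} (hγ : 0 < γ) (hγβ : γ ≤ g.β)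
    (hγl : γ < (2 - g.k₃ * ((g.k₂ + √(g.k₁ ^ 2 + g.k₂ ^ 2)) / 2)) / l) :
    HasDecayRate N g γ := by
  intro x₀ q₀ hx₀
  obtain ⟨τ, hτ⟩ := hfeas
  have hdet : g.k₁ ^ 2 < k₀ * g.k₂ := by
    have := hPpos.det_pos
    rw [hP, Matrix.det_fin_two_of] at this
    linarith
  obtain ⟨m, hm, hlow⟩ := exists_quadratic_lower_bound (F := EuclideanSpace ℝ (Fin p)) hk₀ hk₂ hdet
  obtain ⟨R, hR, hxR⟩ := exists_radius (g := g) hτ hd hk₁ hk₂ hk₃ hβ x₀ q₀ hx₀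
  obtain ⟨c, hc, hdecay⟩ := exists_disagreement_decay (k₀ := k₀) hτ
    (fun y hy u => weighted_poincare hconn hd hβ₁ hβ₁' hy u)
    (fun u v => riccati_inner_le hC hB hP hRiccati u v)
    (fun u v => damping_inner_le hk₂ hk₃ u v) hl
    (fun u v => quadratic_upper_bound hl₀ hl₂ hldet u v) hm hlow hk₁ hk₂ hα hk₄ hγl hγβ x₀ q₀
  obtain ⟨K, hK, hlip⟩ := exists_triggerError_le (p := p) hR hk₁ hk₂ hk₃ hα hc hγ.le hγβ
  refine ⟨c, K, R, hc, hK, hR, fun T x q S h hx hq => ?_⟩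
  have hRt : ∀ b : ℝ, (b : EReal) < T → ∀ t ∈ Set.Icc 0 b, ∀ i j, N.graph.Adj i j →
      ‖x t i - x t j - N.d i j‖ ≤ R i j := fun b hb => hxR b x q _ (h.isClosedLoop hb) hx hq
  have hct : ∀ b : ℝ, (b : EReal) < T → ∀ t ∈ Set.Icc 0 b, ∀ i j,
      ‖(x t i - τ i) - (x t j - τ j)‖ ≤ c * Real.exp (-γ * t) ∧
        ‖q t i - q t j‖ ≤ c * Real.exp (-γ * t) := fun b hb =>
    hdecay b x q _ (h.isClosedLoop hb)
      (fun t ht i j hij => (hRt b hb t ht i j hij).trans_lt (hR i j hij)) hx hq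
  have hzt : ∀ b : ℝ, (b : EReal) < T → ∀ t ∈ Set.Icc 0 b, ∀ i j, N.graph.Adj i j →
      ‖x t i - x t j - N.d i j‖ ≤ c * Real.exp (-γ * t) := fun b hb t ht i j hij => by
    have h1 : x t i - x t j - N.d i j = (x t i - τ i) - (x t j - τ j) := by
      rw [← hτ i j hij]
      abel
    rw [h1]
    exact (hct b hb t ht i j).1
  refine ⟨fun t h0 ht i j hij => ⟨hRt t ht t ⟨h0, le_rfl⟩ i j hij, hzt t ht t ⟨h0, le_rfl⟩ i j hij⟩,
    fun t h0 ht i j => (hct t ht t ⟨h0, le_rfl⟩ i j).2, fun i s s' hs => ?_⟩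
  -- At `s'` the error equals the threshold, so the growth bound becomes a lower bound for the gap.
  rw [← h.fire i s s' hs]
  have hs'T := (h.mem_range i s' hs.2.1).2
  exact hlip s' x q _ (h.isClosedLoop hs'T) (hRt s' hs'T) (hzt s' hs'T)
    (fun t ht i j => (hct s' hs'T t ht i j).2) s s' (h.mem_range i s hs.1).1 hs.2.2.1.le le_rfl i

/-- Only `t ≥ T` needs an argument. Then `T` is finite, and bounding the exponentials on `[0, T)`
gives the common gap `α e^{-βT} / K`. -/
lemma IsExecution.finite_triggers {T : EReal} {x q : ℝ → V → EuclideanSpace ℝ (Fin p)}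
    {S : V → Set ℝ} (h : IsExecution N g T x q S) {K γ : ℝ} (hK : 0 < K) (hγ : 0 < γ)
    (hα : 0 < g.α) (hβ : 0 < g.β)
    (hgap : ∀ i s s', IsNextTrigger (S i) s s' →
      g.α * Real.exp (-g.β * s') ≤ K * Real.exp (-γ * s) * (s' - s)) (i : V) (t : ℝ) :
    (S i ∩ Set.Iic t).Finite := by
  rcases lt_or_ge (t : EReal) T with ht | ht
  · exact h.finite i t ht
  · have hrange := h.mem_range i
    have hlt : ∀ s ∈ S i, s < t := fun s hs => by exact_mod_cast (hrange s hs).2.trans_le ht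
    lift T to ℝ using ⟨ne_top_of_le_ne_top (EReal.coe_ne_top t) ht, (EReal.bot_lt_zero.trans h.pos).ne'⟩
    have hlt : ∀ s ∈ S i, s < T := fun s hs => by exact_mod_cast (hrange s hs).2
    refine Set.Finite.inter_of_left (finite_of_gap (T := T)
      (ε := g.α * Real.exp (-g.β * T) / K) (by positivity) hlt
      (fun r hr => h.finite i r (by exact_mod_cast hr)) fun s s' hs => ?_) _
    rw [div_le_iff₀ hK]
    have h1 := hgap i s s' hs
    have h2 : Real.exp (-g.β * T) ≤ Real.exp (-g.β * s') :=
      Real.exp_le_exp.2 (by nlinarith [hlt s' hs.2.1])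
    have h3 : Real.exp (-γ * s) ≤ 1 :=
      Real.exp_le_one_iff.2 (by nlinarith [(hrange s hs.1).1])
    have h4 : 0 ≤ s' - s := sub_nonneg.2 hs.2.2.1.le
    calc g.α * Real.exp (-g.β * T) ≤ g.α * Real.exp (-g.β * s') := by gcongr
      _ ≤ K * Real.exp (-γ * s) * (s' - s) := h1
      _ ≤ K * 1 * (s' - s) := by gcongr
      _ = (s' - s) * K := by ring

lemma IsMaximalExecution.eq_top [Nonempty V] {T : EReal}
    {x q : ℝ → V → EuclideanSpace ℝ (Fin p)} {S : V → Set ℝ} (h : IsMaximalExecution N g T x q S)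
    (hfin : ∀ i, ∀ t : ℝ, (S i ∩ Set.Iic t).Finite) (hk₃ : 0 < g.k₃) (hα : 0 < g.α)
    {R : V → V → ℝ} (hR : ∀ i j, N.graph.Adj i j → R i j < N.Δ - ‖N.d i j‖)
    (hxR : ∀ t : ℝ, 0 ≤ t → (t : EReal) < T → ∀ i j, N.graph.Adj i j →
      ‖x t i - x t j - N.d i j‖ ≤ R i j) : T = ⊤ := by
  by_contra hT
  obtain ⟨hex, hmax⟩ := h
  lift T to ℝ using ⟨hT, (EReal.bot_lt_zero.trans hex.pos).ne'⟩
  refine hmax (hex.exists_continuation (fun i => (hfin i T).subset fun s hs => ⟨hs, ?_⟩) hk₃ hα hR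
    fun t h0 ht => hxR t h0 (by exact_mod_cast ht))
  have : s < T := by exact_mod_cast (hex.mem_range i s hs).2
  exact this.le

/-- `n q_i` is the total momentum plus the sum of the differences `q_i - q_j`, and both tend to
zero. -/
lemma IsExecution.tendsto_velocity [Nonempty V] {x q : ℝ → V → EuclideanSpace ℝ (Fin p)}
    {S : V → Set ℝ} (h : IsExecution N g ⊤ x q S) (hfeas : N.Feasible) (hk₃ : 0 < g.k₃)
    (hα : 0 < g.α) (hβ : 0 < g.β) {c γ : ℝ} (hγ : 0 < γ)
    (hq : ∀ t : ℝ, 0 ≤ t → ∀ i j, ‖q t i - q t j‖ ≤ c * Real.exp (-γ * t)) (i : V) :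
    Tendsto (fun t => q t i) atTop (𝓝 0) := by
  obtain ⟨τ, hτ⟩ := hfeas
  have hexp : ∀ c γ : ℝ, 0 < γ → Tendsto (fun t => c * Real.exp (-γ * t)) atTop (𝓝 0) := by
    intro c γ hγ
    have : Tendsto (fun t : ℝ => -γ * t) atTop atBot :=
      tendsto_id.const_mul_atTop_of_neg (neg_lt_zero.2 hγ)
    simpa using (Real.tendsto_exp_atBot.comp this).const_mul c
  obtain ⟨c', γ', hγ', hsum⟩ := exists_sum_velocity_decay (g := g) hτ hk₃ hβ hα (q 0)
  have h1 : Tendsto (fun t => ∑ j, q t j) atTop (𝓝 0) := by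
    refine squeeze_zero_norm' ?_ (hexp c' γ' hγ')
    filter_upwards [eventually_ge_atTop 0] with t ht
    exact hsum t x q _ (h.isClosedLoop (EReal.coe_lt_top t)) rfl t ⟨ht, le_rfl⟩
  have h2 : ∀ j, Tendsto (fun t => q t i - q t j) atTop (𝓝 0) := fun j => by
    refine squeeze_zero_norm' ?_ (hexp c γ hγ)
    filter_upwards [eventually_ge_atTop 0] with t ht
    exact hq t ht i j
  have h3 : Tendsto (fun t => (Fintype.card V : ℝ)⁻¹ • (∑ j, q t j + ∑ j, (q t i - q t j))) atTop
      (𝓝 ((Fintype.card V : ℝ)⁻¹ • (0 + ∑ _j : V, (0 : EuclideanSpace ℝ (Fin p))))) :=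
    (h1.add (tendsto_finsetSum _ fun j _ => h2 j)).const_smul _
  have hn : (Fintype.card V : ℝ) ≠ 0 := by exact_mod_cast Fintype.card_ne_zero
  have h4 : ∀ t, (Fintype.card V : ℝ)⁻¹ • (∑ j, q t j + ∑ j, (q t i - q t j)) = q t i := fun t => by
    rw [Finset.sum_sub_distrib, add_sub_cancel, Finset.sum_const, Finset.card_univ,
      ← Nat.cast_smul_eq_nsmul ℝ, smul_smul, inv_mul_cancel₀ hn, one_smul]
  simpa only [h4, Finset.sum_const_zero, add_zero, smul_zero] using h3

end Estimates

end FormationControl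

end

/-! ### Choice of the rates and conclusion -/

theorem theorem2 {V : Type*} [Fintype V] [Nontrivial V] {p : ℕ}
    (N : FormationControl.Network V p) (hconn : N.graph.Connected)
    (hfeas : N.Feasible) (hd : ∀ i j, N.graph.Adj i j → ‖N.d i j‖ < N.Δ)
    (g : FormationControl.Gains) (β₁ k₀ k₄ : ℝ) (P C : Matrix (Fin 2) (Fin 2) ℝ)
    (B : Matrix (Fin 2) (Fin 1) ℝ)
    (hC : C = !![0, 1; 0, 0]) (hB : B = !![0; 1])
    (hβ₁ : 0 < β₁) (hβ₁' : β₁ ≤ N.β₀)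
    (hk₀ : 0 < k₀) (hk₁ : 0 < g.k₁) (hk₂ : 0 < g.k₂)
    (hP : P = !![k₀, g.k₁; g.k₁, g.k₂]) (hPpos : P.PosDef)
    (hRiccati : (-((1 / 2 : ℝ) • (P * C + Cᵀ * P) - β₁ • (P * B * Bᵀ * P)
      + (2 : ℝ) • (1 : Matrix (Fin 2) (Fin 2) ℝ))).PosSemidef)
    (hk₃ : 0 < g.k₃) (hk₃' : g.k₃ < 4 / (g.k₂ + √(g.k₁ ^ 2 + g.k₂ ^ 2)))
    (hk₄ : k₄ = g.k₃ * ((g.k₂ + √(g.k₁ ^ 2 + g.k₂ ^ 2)) / 2))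
    (hα : 0 < g.α) (hβ : 0 < g.β)
    (hβ' : g.β < (2 - k₄) * FormationControl.minPosEigenvalue P) :
    (∃ γ : ℝ, 0 < γ ∧
      ∀ x₀ q₀ : V → EuclideanSpace ℝ (Fin p), N.InitialOK x₀ →
      ∃ c : ℝ, ∀ (T : EReal) (x q : ℝ → V → EuclideanSpace ℝ (Fin p)) (S : V → Set ℝ),
        FormationControl.IsExecution N g T x q S → x 0 = x₀ → q 0 = q₀ →
        (FormationControl.IsMaximalExecution N g T x q S → T = ⊤) ∧
        (∀ i, ∀ t : ℝ, (S i ∩ Set.Iic t).Finite) ∧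
        (∀ i j, N.graph.Adj i j → ∀ t : ℝ, 0 ≤ t → (t : EReal) < T →
          ‖x t i - x t j‖ ≤ N.Δ ∧
          ‖x t i - x t j - N.d i j‖ ≤ c * Real.exp (-γ * t)) ∧
        (∀ i j, ∀ t : ℝ, 0 ≤ t → (t : EReal) < T →
          ‖q t i - q t j‖ ≤ c * Real.exp (-γ * t)) ∧
        (T = ⊤ → ∀ i, Tendsto (fun t => q t i) atTop (𝓝 0))) ∧
    (g.β < (2 - k₄) / (spectralRadius ℝ P).toReal →
      ∀ x₀ q₀ : V → EuclideanSpace ℝ (Fin p), N.InitialOK x₀ →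
      ∃ (c : ℝ) (ξ : V → ℝ), (∀ i, 0 < ξ i) ∧
        ∀ (T : EReal) (x q : ℝ → V → EuclideanSpace ℝ (Fin p)) (S : V → Set ℝ),
        FormationControl.IsExecution N g T x q S → x 0 = x₀ → q 0 = q₀ →
        (∀ i j, N.graph.Adj i j → ∀ t : ℝ, 0 ≤ t → (t : EReal) < T →
          ‖x t i - x t j - N.d i j‖ ≤ c * Real.exp (-g.β * t)) ∧
        (∀ i j, ∀ t : ℝ, 0 ≤ t → (t : EReal) < T →
          ‖q t i - q t j‖ ≤ c * Real.exp (-g.β * t)) ∧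
        (∀ i s s', FormationControl.IsNextTrigger (S i) s s' → ξ i ≤ s' - s)) := by
  have hs0 : 0 < g.k₂ + √(g.k₁ ^ 2 + g.k₂ ^ 2) := by positivity
  have hk₄2 : g.k₃ * ((g.k₂ + √(g.k₁ ^ 2 + g.k₂ ^ 2)) / 2) < 2 := by
    rw [lt_div_iff₀ hs0] at hk₃'
    linarith
  obtain ⟨l, hl, hl₀, hl₂, hldet, hlρ⟩ :=
    FormationControl.exists_max_eigenvalue_fin_two (b := g.k₁) (c := g.k₂) hk₀
  have hrate : ∀ γ : ℝ, 0 < γ → γ ≤ g.β → γ < (2 - k₄) / l →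
      FormationControl.HasDecayRate N g γ := fun γ hγ hγβ hγl =>
    FormationControl.hasDecayRate hconn hfeas hd hC hB hβ₁ hβ₁' hk₀ hk₁ hk₂ hP hPpos hRiccati
      hk₃ hk₄2 hα hβ hl hl₀ hl₂ hldet hγ hγβ (by rwa [← hk₄])
  rw [← hk₄] at hk₄2
  have hμ : 0 < (2 - k₄) / l := div_pos (by linarith) hl
  constructor
  -- Half of the critical rate, because the decay estimate needs a rate strictly below `(2 - k₄)/l`.
  · have hγ : 0 < min g.β ((2 - k₄) / l / 2) := lt_min hβ (by linarith)
    refine ⟨_, hγ, fun x₀ q₀ hx₀ => ?_⟩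
    obtain ⟨c, K, R, -, hK, hR, hex⟩ := hrate _ hγ (min_le_left _ _)
      ((min_le_right _ _).trans_lt (by linarith)) x₀ q₀ hx₀
    refine ⟨c, fun T x q S h hx hq => ?_⟩
    obtain ⟨hxc, hqc, hgap⟩ := hex T x q S h hx hq
    have hfin := h.finite_triggers hK hγ hα hβ hgap
    refine ⟨fun hmax => hmax.eq_top hfin hk₃ hα hR fun t h0 ht i j hij => (hxc t h0 ht i j hij).1,
      hfin, fun i j hij t h0 ht => ⟨?_, (hxc t h0 ht i j hij).2⟩,
      fun i j t h0 ht => hqc t h0 ht i j, ?_⟩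
    · have h1 := norm_add_le (x t i - x t j - N.d i j) (N.d i j)
      rw [sub_add_cancel] at h1
      have h2 := (hxc t h0 ht i j hij).1
      have h3 := hR i j hij
      linarith
    · rintro rfl i
      exact h.tendsto_velocity hfeas hk₃ hα hβ hγ
        (fun t h0 i j => hqc t h0 (EReal.coe_lt_top t) i j) i
  · intro hβρ x₀ q₀ hx₀
    rw [hP] at hβρ
    -- Since `l ≤ ρ(P)`, the rate `β` itself becomes admissible.
    have hβl : g.β < (2 - k₄) / l := hβρ.trans_le (by
      have : 0 ≤ 2 - k₄ := by linarith
      gcongr)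
    obtain ⟨c, K, R, -, hK, hR, hex⟩ := hrate _ hβ le_rfl hβl x₀ q₀ hx₀
    -- With `γ = β` the factor `e^{-βs}` cancels from the gap inequality, leaving `α e^{-β(s' - s)}
    -- ≤ K (s' - s)`; for a gap below `1` the left side is at least `α e^{-β}`.
    refine ⟨c, fun _ => min 1 (g.α * Real.exp (-g.β) / K), fun _ => by positivity,
      fun T x q S h hx hq => ?_⟩
    obtain ⟨hxc, hqc, hgap⟩ := hex T x q S h hx hq
    refine ⟨fun i j hij t h0 ht => (hxc t h0 ht i j hij).2, fun i j t h0 ht => hqc t h0 ht i j,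
      fun i s s' hs => ?_⟩
    by_contra! hlt
    have h1 := hgap i s s' hs
    have h2 : s' - s < 1 := hlt.trans_le (min_le_left _ _)
    have h3 : (s' - s) * K < g.α * Real.exp (-g.β) :=
      (lt_div_iff₀ hK).1 (hlt.trans_le (min_le_right _ _))
    have h4 : Real.exp (-g.β * s') = Real.exp (-g.β * s) * Real.exp (-g.β * (s' - s)) := by
      rw [← Real.exp_add]
      congr 1
      ring
    have h5 : Real.exp (-g.β) ≤ Real.exp (-g.β * (s' - s)) :=
      Real.exp_le_exp.2 (by nlinarith)
    have h6 := Real.exp_pos (-g.β * s)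
    rw [h4] at h1
    have h7 : g.α * Real.exp (-g.β) ≤ g.α * Real.exp (-g.β * (s' - s)) := by gcongr
    have h8 := mul_lt_mul_of_pos_left (h3.trans_le h7) h6
    linarith
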